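/- Let $n\ge 3$, and let $\mathcal K^n$ be the space of convex bodies (nonempty compact convex sets) in $\mathbb R^n$ with the Hausdorff metric. For $K\in\mathcal K^n$ let $K_o=\operatorname{conv}(\{0\}\cup K)$ and let $$m(K)=\int_K x\,dx,\qquad m_*(K)=\int_{K_o\setminus K}x\,dx ,$$ regarded as one-point convex bodies. Let $\mathrm M K,\mathrm M_*K\in\mathcal K^n$ be the convex bodies whose support functions (where $h(L,x)=\max\{\langle x,y\rangle:y\in L\}$) are $$h(\mathrm M K,x)=\int_K|\langle x,y\rangle|\,dy,\qquad h(\mathrm M_*K,x)=\int_{K_o\setminus K}|\langle x,y\rangle|\,dy .$$ A map $\Phi:\mathcal K^n\to\mathcal K^n$ is a Minkowski valuation if $\Phi K+\Phi L=\Phi(K\cup L)+\Phi(K\cap L)$ (Minkowski addition) whenever $K,L,K\cup L,K\cap L\in\mathcal K^n$; it is $SL(n)$ equivariant if $\Phi(\phi K)=\phi\,\Phi K$ for all $\phi\in SL(n)$ and $K\in\mathcal K^n$; it is homogeneous of degree $r$ if $\Phi(\lambda K)=\lambda^r\Phi K$ for all $\lambda>0$ and $K\in\mathcal K^n$. **Theorem.**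 A map $\Phi:\mathcal K^n\to\mathcal K^n$ is an $SL(n)$ equivariant continuous Minkowski valuation that is homogeneous of degree $n+1$ if and only if there are constants $a_1,a_2\in\mathbb R$ and $a_3,a_4\ge 0$ such that $$\Phi K=a_1\,m(K)+a_2\,m_*(K)+a_3\,\mathrm M K+a_4\,\mathrm M_*K\qquad\text{for every }K\in\mathcal K^n .$$ -/

import Mathlib

open scoped Pointwise

noncomputable section

namespace MinkowskiVal

open MeasureTheory

/-- Euclidean `n`-space. Convex bodies in it are the elements of `ConvexBody (Euc n)` (nonempty
compact convex sets), with the Hausdorff metric, Minkowski addition and dilation of Mathlib. -/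
abbrev Euc (n : ℕ) : Type := EuclideanSpace ℝ (Fin n)

variable {n : ℕ}

/-- The support function `h(K, x) = max {⟨x, y⟩ : y ∈ K}`. -/
def supportFn (K : ConvexBody (Euc n)) (x : Euc n) : ℝ :=
  sSup ((fun y : Euc n => inner ℝ x y) '' (K : Set (Euc n)))

/-- The image `f K` of a convex body under a linear map. -/
def mapBody (f : Euc n →L[ℝ] Euc n) (K : ConvexBody (Euc n)) : ConvexBody (Euc n) where
  carrier := f '' (K : Set (Euc n))
  convex' := K.convex.linear_image f.toLinearMap
  isCompact' := K.isCompact.image f.continuous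
  nonempty' := K.nonempty.image f

/-- The one-point convex body `{v}`. -/
def pointBody (v : Euc n) : ConvexBody (Euc n) where
  carrier := {v}
  convex' := convex_singleton v
  isCompact' := isCompact_singleton
  nonempty' := Set.singleton_nonempty v

/-- The convex body `{y : ⟨x, y⟩ ≤ h x for all x}` of a nonnegative function `h`. -/
def bodyOfSupport (h : Euc n → ℝ) (h0 : ∀ x, 0 ≤ h x) : ConvexBody (Euc n) where
  carrier := {y | ∀ x : Euc n, inner ℝ x y ≤ h x}
  convex' := by
    intro y hy z hz a b ha hb hab x
    have h1 := mul_le_mul_of_nonneg_left (hy x) ha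
    have h2 := mul_le_mul_of_nonneg_left (hz x) hb
    rw [inner_add_right, real_inner_smul_right, real_inner_smul_right]
    have h3 : a * h x + b * h x = h x := by rw [← add_mul, hab, one_mul]
    linarith
  isCompact' := by
    refine Metric.isCompact_of_isClosed_isBounded ?_ ?_
    · simp only [Set.ofPred_forall]
      exact isClosed_iInter fun x => isClosed_le (by fun_prop) continuous_const
    · let e : Fin n → Euc n := fun i => EuclideanSpace.single i (1 : ℝ)
      refine (Metric.isBounded_iff_subset_closedBall (0 : Euc n)).2
        ⟨∑ i, (h (e i) + h (-e i)), fun y hy => ?_⟩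
      rw [mem_closedBall_zero_iff]
      have hb : ∀ i, |y i| ≤ h (e i) + h (-e i) := by
        intro i
        have h1 := hy (e i)
        have h2 := hy (-e i)
        have h3 : inner ℝ (e i) y = y i := by simp [e, EuclideanSpace.inner_single_left]
        rw [inner_neg_left] at h2
        rw [h3] at h1 h2
        have h4 := h0 (e i)
        have h5 := h0 (-e i)
        exact abs_le.2 ⟨by linarith, by linarith⟩
      have hy' : y = ∑ i, y i • e i := by
        ext j
        simp [e, Finset.sum_apply, Pi.single_apply]
      calc ‖y‖ = ‖∑ i, y i • e i‖ := by rw [← hy']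
        _ ≤ ∑ i, ‖y i • e i‖ := norm_sum_le _ _
        _ ≤ ∑ i, (h (e i) + h (-e i)) := by
          refine Finset.sum_le_sum fun i _ => ?_
          rw [norm_smul]
          simpa [e] using hb i
  nonempty' := ⟨0, fun x => by simpa using h0 x⟩

/-- A sublinear function is the support function of the body it defines. -/
theorem supportFn_bodyOfSupport (h : Euc n → ℝ) (h0 : ∀ x, 0 ≤ h x)
    (hadd : ∀ x y, h (x + y) ≤ h x + h y) (hsmul : ∀ c : ℝ, 0 < c → ∀ x, h (c • x) = c * h x)
    (x : Euc n) : supportFn (bodyOfSupport h h0) x = h x := by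
  have hz : h 0 = 0 := by
    have := hsmul 2 (by norm_num) 0
    rw [smul_zero] at this
    linarith
  have hle : ∀ y ∈ (bodyOfSupport h h0 : Set (Euc n)), inner ℝ x y ≤ h x := fun y hy => hy x
  have hex : ∃ y ∈ (bodyOfSupport h h0 : Set (Euc n)), inner ℝ x y = h x := by
    rcases eq_or_ne x 0 with rfl | hx
    · exact ⟨0, fun z => by simpa using h0 z, by simp [hz]⟩
    obtain ⟨g, hg1, hg2⟩ := exists_extension_of_le_sublinear
      (LinearPMap.mkSpanSingleton x (h x) hx) h hsmul hadd (by
        rintro ⟨z, hzm⟩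
        obtain ⟨c, rfl⟩ := Submodule.mem_span_singleton.1 hzm
        have hval : LinearPMap.mkSpanSingleton x (h x) hx ⟨c • x, hzm⟩ = c * h x :=
          LinearPMap.mkSpanSingleton'_apply _ _ _ _ _
        rw [hval]
        show c * h x ≤ h (c • x)
        rcases lt_trichotomy c 0 with hc | hc | hc
        · exact (mul_nonpos_of_nonpos_of_nonneg hc.le (h0 x)).trans (h0 _)
        · simp [hc, hz]
        · exact (hsmul c hc x).ge)
    have hgx : g x = h x := by
      have h1 := hg1 ⟨x, Submodule.mem_span_singleton_self x⟩
      have h2 := LinearPMap.mkSpanSingleton_apply ℝ ℝ (σ := RingHom.id ℝ) hx (h x)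
      exact h1.trans h2
    have hrep : ∀ z, inner ℝ z ((InnerProductSpace.toDual ℝ (Euc n)).symm
        (LinearMap.toContinuousLinearMap g)) = g z := by
      intro z
      rw [real_inner_comm, InnerProductSpace.toDual_symm_apply]
      rfl
    exact ⟨_, fun z => (hrep z).le.trans (hg2 z), (hrep x).trans hgx⟩
  obtain ⟨y, hy, hyx⟩ := hex
  refine IsGreatest.csSup_eq ⟨⟨y, hy, hyx⟩, ?_⟩
  rintro _ ⟨z, hz', rfl⟩
  exact hle z hz'

/-- The convex body with support function `x ↦ ∫_S |⟨x, y⟩| dy`, for a bounded set `S`. -/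
def momentBodyOfSet (S : Set (Euc n)) : ConvexBody (Euc n) :=
  bodyOfSupport (fun x => ∫ y in S, |inner ℝ x y|)
    (fun _ => integral_nonneg fun _ => abs_nonneg _)

theorem supportFn_momentBodyOfSet {S : Set (Euc n)} (hS : Bornology.IsBounded S) (x : Euc n) :
    supportFn (momentBodyOfSet S) x = ∫ y in S, |inner ℝ x y| := by
  have hint : ∀ x : Euc n, IntegrableOn (fun y : Euc n => |inner ℝ x y|) S := by
    intro x
    obtain ⟨r, hr⟩ := (Metric.isBounded_iff_subset_closedBall (0 : Euc n)).1 hS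
    have hc : Continuous fun y : Euc n => |inner ℝ x y| := by fun_prop
    exact (hc.continuousOn.integrableOn_compact (isCompact_closedBall (0 : Euc n) r)).mono_set hr
  refine supportFn_bodyOfSupport _ _ (fun a b => ?_) (fun c hc a => ?_) x
  · rw [← integral_add (hint a) (hint b)]
    refine integral_mono (hint (a + b)) ((hint a).add (hint b)) fun y => ?_
    simp only [inner_add_left]
    exact abs_add_le _ _
  · rw [← integral_const_mul]
    simp only [real_inner_smul_left, abs_mul, abs_of_pos hc]

/-- `K_o = conv ({0} ∪ K)`. -/
def hullZero (K : ConvexBody (Euc n)) : Set (Euc n) :=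
  convexHull ℝ (insert 0 (K : Set (Euc n)))

/-- The moment vector `m(K) = ∫_K x dx`, as a one-point body. -/
def momentVector (K : ConvexBody (Euc n)) : ConvexBody (Euc n) :=
  pointBody (∫ x in (K : Set (Euc n)), x)

/-- `m_*(K) = ∫_{K_o \ K} x dx`, as a one-point body. -/
def momentVectorStar (K : ConvexBody (Euc n)) : ConvexBody (Euc n) :=
  pointBody (∫ x in hullZero K \ (K : Set (Euc n)), x)

/-- The moment body `M K`, with support function `∫_K |⟨x, y⟩| dy`. -/
def momentBody (K : ConvexBody (Euc n)) : ConvexBody (Euc n) :=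
  momentBodyOfSet (K : Set (Euc n))

/-- The body `M_* K`, with support function `∫_{K_o \ K} |⟨x, y⟩| dy`. -/
def momentBodyStar (K : ConvexBody (Euc n)) : ConvexBody (Euc n) :=
  momentBodyOfSet (hullZero K \ (K : Set (Euc n)))

theorem supportFn_momentBody (K : ConvexBody (Euc n)) (x : Euc n) :
    supportFn (momentBody K) x = ∫ y in (K : Set (Euc n)), |inner ℝ x y| :=
  supportFn_momentBodyOfSet K.isBounded x

theorem supportFn_momentBodyStar (K : ConvexBody (Euc n)) (x : Euc n) :
    supportFn (momentBodyStar K) x =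
      ∫ y in hullZero K \ (K : Set (Euc n)), |inner ℝ x y| :=
  supportFn_momentBodyOfSet
    ((isBounded_convexHull.2 (K.isBounded.insert 0)).subset Set.sdiff_subset) x

/-- `Φ K + Φ L = Φ (K ∪ L) + Φ (K ∩ L)` whenever `K`, `L`, `K ∪ L`, `K ∩ L` are convex bodies;
here `U` is `K ∪ L` and `I` is `K ∩ L`. -/
def IsMinkowskiValuation (Φ : ConvexBody (Euc n) → ConvexBody (Euc n)) : Prop :=
  ∀ K L U I : ConvexBody (Euc n),
    (U : Set (Euc n)) = (K : Set (Euc n)) ∪ (L : Set (Euc n)) →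
    (I : Set (Euc n)) = (K : Set (Euc n)) ∩ (L : Set (Euc n)) →
    Φ K + Φ L = Φ U + Φ I

/-- `Φ (φ K) = φ (Φ K)` for all `φ ∈ SL(n)`. -/
def IsSLEquivariant (Φ : ConvexBody (Euc n) → ConvexBody (Euc n)) : Prop :=
  ∀ (φ : Matrix.SpecialLinearGroup (Fin n) ℝ) (K : ConvexBody (Euc n)),
    Φ (mapBody (Matrix.toEuclideanCLM (n := Fin n) (𝕜 := ℝ) (φ : Matrix (Fin n) (Fin n) ℝ)) K) =
      mapBody (Matrix.toEuclideanCLM (n := Fin n) (𝕜 := ℝ) (φ : Matrix (Fin n) (Fin n) ℝ)) (Φ K)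

/-- `Φ (c K) = c ^ r Φ K` for all `c > 0`. -/
def IsHomogeneousOfDegree (r : ℝ) (Φ : ConvexBody (Euc n) → ConvexBody (Euc n)) : Prop :=
  ∀ (c : ℝ), 0 < c → ∀ K : ConvexBody (Euc n), Φ (c • K) = (c ^ r) • Φ K

end MinkowskiVal

end

/-!
The support function `h(Φ K, x)` of a map as in the theorem is a *covariant valuation*
(`IsCovariantValuation`, `isCovariantValuation_supportFn_iff`): it is a continuous valuation in `K`,
and equivariance together with the degree `n + 1` says that
`h(Φ (A K), x) = det A · h(Φ K, Aᵀ x)` whenever `det A > 0`. The integrals `∫_K ⟨x, y⟩ dy` and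
`∫_K |⟨x, y⟩| dy` are covariant valuations as well (`isCovariantValuation_momentFn`), and so are
their compositions with `K ↦ K_o` (`IsCovariantValuation.comp_hullBody`). As covariant valuations
form a vector space and bodies are determined by their support functions, this settles one
direction of the theorem. It also reduces the other one to a uniqueness statement,
`IsCovariantValuation.eq_zero`: a covariant valuation `R` vanishes if it vanishes at the simplex
`T = conv {0, e₁, …, eₙ}` and at its facet `S = conv {e₁, …, eₙ}` in the two directions
`±(1, …, 1)`. Indeed the values of `h(Φ T, ·)` at `±(1, …, 1)` can be matched by a choice of `a₁`
and `a₃`, those of `h(Φ S, ·)` by a choice of `a₂` and `a₄`, and `a₃, a₄ ≥ 0` because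
`h(L, x) + h(L, -x) ≥ 0` for every body `L`.

The proof of uniqueness starts from the observation that `R` vanishes on bodies in a hyperplane
through the origin, as dilations orthogonal to the hyperplane show. Hence `R` is additive when a
body is cut by such a hyperplane. Cutting `T` (or `S`) by the hyperplane through the point
`s e_a + t e_b` of an edge and the remaining vertices yields two linear images of `T`, and
covariance turns additivity into the functional equation
`G(x) = t G(x[b ↦ s x_a + t x_b]) + s G(x[a ↦ s x_a + t x_b])` for `G = R(T, ·)`. It expresses
`G(x)` as an average of values at points of the same cube, so by the maximum principle `G` attains
its extrema over a cube on the diagonal, where it vanishes (`eq_zero_of_cut_equation`). Therefore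
`R` vanishes at all simplices with vertex `0` and at their facets opposite to `0`.

To pass to polytopes, write them as intersections of a simplex with half-spaces and remove the
half-spaces one at a time. When a hyperplane separates two vertices of the simplex, cut the simplex
at the point where the hyperplane meets the edge; after finitely many cuts all vertices other than
`0` are on one side (`edge_induction`), and then the half-space cuts off nothing, everything, or
again a simplex with vertex `0`. This is done first for simplices in a hyperplane that does not
contain the origin, which shows that `R` vanishes on all bodies in hyperplanes, and then for
simplices with vertex `0`. By continuity `R` vanishes at every body contained in such a simplex, and
every body is cut into such pieces by the coordinate hyperplanes.
-/

open scoped Pointwise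

noncomputable section

namespace MinkowskiVal

open MeasureTheory Filter Topology Metric

variable {n : ℕ}

/-! ### Support functions -/

theorem bddAbove_inner_image (K : ConvexBody (Euc n)) (x : Euc n) :
    BddAbove ((fun y : Euc n => inner ℝ x y) '' (K : Set (Euc n))) :=
  (K.isCompact.image (by fun_prop)).bddAbove

theorem inner_le_supportFn (K : ConvexBody (Euc n)) (x : Euc n) {y : Euc n}
    (hy : y ∈ (K : Set (Euc n))) : inner ℝ x y ≤ supportFn K x :=
  le_csSup (bddAbove_inner_image K x) ⟨y, hy, rfl⟩

theorem exists_inner_eq_supportFn (K : ConvexBody (Euc n)) (x : Euc n) :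
    ∃ y ∈ (K : Set (Euc n)), inner ℝ x y = supportFn K x :=
  (K.isCompact.image (f := fun y : Euc n => inner ℝ x y) (by fun_prop)).sSup_mem
    (K.nonempty.image _)

theorem supportFn_eq_of {K : ConvexBody (Euc n)} {x : Euc n} {c : ℝ}
    (hle : ∀ y ∈ (K : Set (Euc n)), inner ℝ x y ≤ c)
    (hex : ∃ y ∈ (K : Set (Euc n)), inner ℝ x y = c) : supportFn K x = c := by
  obtain ⟨y, hy, hyx⟩ := hex
  obtain ⟨z, hz, hzx⟩ := exists_inner_eq_supportFn K x
  exact le_antisymm (hzx ▸ hle z hz) (hyx ▸ inner_le_supportFn K x hy)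

theorem supportFn_add (K L : ConvexBody (Euc n)) (x : Euc n) :
    supportFn (K + L) x = supportFn K x + supportFn L x := by
  refine supportFn_eq_of ?_ ?_
  · rintro _ ⟨y, hy, z, hz, rfl⟩
    rw [inner_add_right]
    exact add_le_add (inner_le_supportFn K x hy) (inner_le_supportFn L x hz)
  · obtain ⟨y, hy, h1⟩ := exists_inner_eq_supportFn K x
    obtain ⟨z, hz, h2⟩ := exists_inner_eq_supportFn L x
    exact ⟨y + z, ⟨y, hy, z, hz, rfl⟩, by rw [inner_add_right, h1, h2]⟩

theorem supportFn_smul {c : ℝ} (hc : 0 ≤ c) (K : ConvexBody (Euc n)) (x : Euc n) :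
    supportFn (c • K) x = c * supportFn K x := by
  refine supportFn_eq_of ?_ ?_
  · rintro _ ⟨y, hy, rfl⟩
    simp only [real_inner_smul_right]
    exact mul_le_mul_of_nonneg_left (inner_le_supportFn K x hy) hc
  · obtain ⟨y, hy, h1⟩ := exists_inner_eq_supportFn K x
    exact ⟨c • y, ⟨y, hy, rfl⟩, by rw [real_inner_smul_right, h1]⟩

theorem supportFn_smul_right {c : ℝ} (hc : 0 ≤ c) (K : ConvexBody (Euc n)) (x : Euc n) :
    supportFn K (c • x) = c * supportFn K x := by
  refine supportFn_eq_of ?_ ?_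
  · intro y hy
    rw [real_inner_smul_left]
    exact mul_le_mul_of_nonneg_left (inner_le_supportFn K x hy) hc
  · obtain ⟨y, hy, h1⟩ := exists_inner_eq_supportFn K x
    exact ⟨y, hy, by rw [real_inner_smul_left, h1]⟩

theorem supportFn_smul_pointBody (a : ℝ) (v x : Euc n) :
    supportFn (a • pointBody v) x = a * inner ℝ v x := by
  have hmem : a • v ∈ ((a • pointBody v : ConvexBody (Euc n)) : Set (Euc n)) := ⟨v, rfl, rfl⟩
  refine supportFn_eq_of ?_ ⟨a • v, hmem, by rw [real_inner_smul_right, real_inner_comm]⟩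
  rintro _ ⟨y, rfl, rfl⟩
  simp only [real_inner_smul_right, real_inner_comm, le_refl]

theorem supportFn_mapBody (f : Euc n →L[ℝ] Euc n) (K : ConvexBody (Euc n)) (x : Euc n) :
    supportFn (mapBody f K) x = supportFn K (ContinuousLinearMap.adjoint f x) := by
  refine supportFn_eq_of ?_ ?_
  · rintro _ ⟨y, hy, rfl⟩
    rw [← ContinuousLinearMap.adjoint_inner_left]
    exact inner_le_supportFn K _ hy
  · obtain ⟨y, hy, h1⟩ := exists_inner_eq_supportFn K (ContinuousLinearMap.adjoint f x)
    exact ⟨f y, ⟨y, hy, rfl⟩, by rw [← ContinuousLinearMap.adjoint_inner_left, h1]⟩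

theorem neg_supportFn_neg_le (K : ConvexBody (Euc n)) (x : Euc n) :
    -supportFn K (-x) ≤ supportFn K x := by
  obtain ⟨y, hy⟩ := K.nonempty
  have h1 := inner_le_supportFn K x hy
  have h2 := inner_le_supportFn K (-x) hy
  rw [inner_neg_left] at h2
  linarith

theorem continuous_supportFn (K : ConvexBody (Euc n)) : Continuous (supportFn K) := by
  obtain ⟨C, hC⟩ := K.isBounded.exists_norm_le
  have key : ∀ x y : Euc n, supportFn K x ≤ supportFn K y + C * dist x y := by
    intro x y
    obtain ⟨z, hz, h1⟩ := exists_inner_eq_supportFn K x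
    have h2 := inner_le_supportFn K y hz
    have h3 : inner ℝ (x - y) z ≤ C * dist x y := by
      calc inner ℝ (x - y) z ≤ ‖x - y‖ * ‖z‖ := real_inner_le_norm _ _
        _ ≤ ‖x - y‖ * C := by gcongr; exact hC z hz
        _ = C * dist x y := by rw [dist_eq_norm, mul_comm]
    rw [inner_sub_left] at h3
    linarith
  have hC0 : 0 ≤ C := by
    obtain ⟨y, hy⟩ := K.nonempty
    exact (norm_nonneg y).trans (hC y hy)
  exact (LipschitzWith.of_le_add_mul ⟨C, hC0⟩ key).continuous

/-- A point outside a convex body is separated from it, with a quantitative gap, by the direction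
towards its nearest point. -/
theorem exists_supportFn_add_norm_sq_le (K : ConvexBody (Euc n)) (y : Euc n) :
    ∃ z ∈ (K : Set (Euc n)), supportFn K (y - z) + ‖y - z‖ ^ 2 ≤ inner ℝ (y - z) y := by
  obtain ⟨z, hz, hmin⟩ := exists_norm_eq_iInf_of_complete_convex K.nonempty
    K.isCompact.isComplete K.convex y
  have h := (norm_eq_iInf_iff_real_inner_le_zero K.convex hz).1 hmin
  refine ⟨z, hz, ?_⟩
  obtain ⟨w, hw, h1⟩ := exists_inner_eq_supportFn K (y - z)
  have h2 := h w hw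
  rw [inner_sub_right] at h2
  have h3 : ‖y - z‖ ^ 2 = inner ℝ (y - z) y - inner ℝ (y - z) z := by
    rw [← inner_sub_right, real_inner_self_eq_norm_sq]
  linarith

theorem dist_le_of_supportFn {K L : ConvexBody (Euc n)} {ε : ℝ} (hε : 0 ≤ ε)
    (h : ∀ x, |supportFn K x - supportFn L x| ≤ ε * ‖x‖) : dist K L ≤ ε := by
  have key : ∀ K L : ConvexBody (Euc n), (∀ x, supportFn K x ≤ supportFn L x + ε * ‖x‖) →
      ∀ y ∈ (K : Set (Euc n)), ∃ z ∈ (L : Set (Euc n)), dist y z ≤ ε := by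
    intro K L hKL y hy
    obtain ⟨z, hz, h1⟩ := exists_supportFn_add_norm_sq_le L y
    refine ⟨z, hz, ?_⟩
    have h2 := inner_le_supportFn K (y - z) hy
    have h3 := hKL (y - z)
    rw [dist_eq_norm]
    by_contra! hcon
    nlinarith [norm_nonneg (y - z)]
  refine hausdorffDist_le_of_mem_dist hε (key K L fun x => ?_) (key L K fun x => ?_)
  · linarith [(abs_le.1 (h x)).2]
  · linarith [(abs_le.1 (h x)).1]

theorem abs_supportFn_sub_le (K L : ConvexBody (Euc n)) (x : Euc n) :
    |supportFn K x - supportFn L x| ≤ dist K L * ‖x‖ := by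
  have key : ∀ K L : ConvexBody (Euc n), supportFn K x ≤ supportFn L x + dist K L * ‖x‖ := by
    intro K L
    obtain ⟨y, hy, h1⟩ := exists_inner_eq_supportFn K x
    obtain ⟨z, hz, h2⟩ := L.isCompact.exists_infDist_eq_dist L.nonempty y
    have h3 : dist y z ≤ dist K L := by
      rw [← h2]
      exact infDist_le_hausdorffDist_of_mem hy ConvexBody.hausdorffEDist_ne_top
    have h4 : inner ℝ x (y - z) ≤ dist K L * ‖x‖ := by
      calc inner ℝ x (y - z) ≤ ‖x‖ * ‖y - z‖ := real_inner_le_norm _ _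
        _ ≤ ‖x‖ * dist K L := by gcongr; rwa [← dist_eq_norm]
        _ = _ := mul_comm _ _
    rw [inner_sub_right] at h4
    linarith [inner_le_supportFn L x hz]
  rw [abs_le]
  have h1 := key K L
  have h2 := key L K
  rw [dist_comm] at h2
  constructor <;> linarith

theorem supportFn_injective : Function.Injective (supportFn (n := n)) := by
  intro K L h
  refine dist_le_zero.1 (dist_le_of_supportFn le_rfl fun x => ?_)
  simp [h]

/-! ### Covariant valuations -/

/-- The linear map of Euclidean space with matrix `A`. -/
abbrev matCLM (A : Matrix (Fin n) (Fin n) ℝ) : Euc n →L[ℝ] Euc n :=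
  Matrix.toEuclideanCLM (n := Fin n) (𝕜 := ℝ) A

theorem matCLM_apply (A : Matrix (Fin n) (Fin n) ℝ) (x : Euc n) (i : Fin n) :
    matCLM A x i = ∑ j, A i j * x j := by
  simp [matCLM, Matrix.ofLp_toEuclideanCLM, Matrix.mulVec, dotProduct]

theorem adjoint_matCLM (A : Matrix (Fin n) (Fin n) ℝ) :
    ContinuousLinearMap.adjoint (matCLM A) = matCLM A.transpose := by
  rw [← ContinuousLinearMap.star_eq_adjoint, matCLM, matCLM, ← map_star,
    Matrix.star_eq_conjTranspose, Matrix.conjTranspose_eq_transpose_of_trivial]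

theorem matCLM_smul (c : ℝ) (A : Matrix (Fin n) (Fin n) ℝ) (x : Euc n) :
    matCLM (c • A) x = c • matCLM A x := by
  simp [matCLM]

/-- The common properties of the functions `(K, x) ↦ h(Φ K, x)` for `Φ` as in the classification,
and of `(K, x) ↦ ∫_K |⟨x, y⟩| dy`: the valuation property, continuity in `K` uniformly on the unit
sphere, continuity and positive homogeneity in `x`, and covariance under linear maps of positive
determinant. Unlike support functions, the functions with these properties form a vector space. -/
structure IsCovariantValuation (R : ConvexBody (Euc n) → Euc n → ℝ) : Prop where
  val : ∀ K L U I : ConvexBody (Euc n),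
    (U : Set (Euc n)) = (K : Set (Euc n)) ∪ (L : Set (Euc n)) →
    (I : Set (Euc n)) = (K : Set (Euc n)) ∩ (L : Set (Euc n)) →
    ∀ x, R K x + R L x = R U x + R I x
  cont : ∀ K : ConvexBody (Euc n), ∀ ε : ℝ, 0 < ε →
    ∀ᶠ L in 𝓝 K, ∀ x, |R L x - R K x| ≤ ε * ‖x‖
  contRight : ∀ K, Continuous (R K)
  hom : ∀ K, ∀ c : ℝ, 0 ≤ c → ∀ x, R K (c • x) = c * R K x
  cov : ∀ A : Matrix (Fin n) (Fin n) ℝ, 0 < A.det → ∀ K x,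
    R (mapBody (matCLM A) K) x = A.det * R K (matCLM A.transpose x)

namespace IsCovariantValuation

variable {R R' : ConvexBody (Euc n) → Euc n → ℝ}

theorem add (h : IsCovariantValuation R) (h' : IsCovariantValuation R') :
    IsCovariantValuation (fun K x => R K x + R' K x) where
  val K L U I hU hI x := by linarith [h.val K L U I hU hI x, h'.val K L U I hU hI x]
  cont K ε hε := by
    filter_upwards [h.cont K (ε / 2) (by linarith), h'.cont K (ε / 2) (by linarith)]
      with L h1 h2 x
    have h3 := abs_le.1 (h1 x)
    have h4 := abs_le.1 (h2 x)
    rw [abs_le]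
    constructor <;> linarith
  contRight K := (h.contRight K).add (h'.contRight K)
  hom K c hc x := by rw [h.hom K c hc, h'.hom K c hc, mul_add]
  cov A hA K x := by rw [h.cov A hA, h'.cov A hA, mul_add]

theorem const_mul (h : IsCovariantValuation R) (a : ℝ) :
    IsCovariantValuation (fun K x => a * R K x) where
  val K L U I hU hI x := by rw [← mul_add, ← mul_add, h.val K L U I hU hI x]
  cont K ε hε := by
    have ha : 0 < |a| + 1 := by positivity
    filter_upwards [h.cont K (ε / (|a| + 1)) (by positivity)] with L h1 x
    rw [← mul_sub, abs_mul]
    calc |a| * |R L x - R K x| ≤ (|a| + 1) * (ε / (|a| + 1) * ‖x‖) := by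
          gcongr
          · linarith
          · exact h1 x
      _ = ε * ‖x‖ := by field_simp
  contRight K := (h.contRight K).const_mul a
  hom K c hc x := by rw [h.hom K c hc]; ring
  cov A hA K x := by rw [h.cov A hA]; ring

theorem sub (h : IsCovariantValuation R) (h' : IsCovariantValuation R') :
    IsCovariantValuation (fun K x => R K x - R' K x) := by
  have := h.add (h'.const_mul (-1))
  simpa [sub_eq_add_neg] using this

theorem tendsto (h : IsCovariantValuation R) (K : ConvexBody (Euc n)) (x : Euc n) :
    Tendsto (fun L => R L x) (𝓝 K) (𝓝 (R K x)) := by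
  rw [Metric.tendsto_nhds]
  intro ε hε
  have hx : 0 < ‖x‖ + 1 := by positivity
  filter_upwards [h.cont K (ε / (‖x‖ + 1)) (by positivity)] with L h1
  rw [Real.dist_eq]
  refine (h1 x).trans_lt ?_
  rw [div_mul_eq_mul_div, div_lt_iff₀ hx]
  nlinarith

end IsCovariantValuation

theorem smul_mapBody (c : ℝ) (A : Matrix (Fin n) (Fin n) ℝ) (K : ConvexBody (Euc n)) :
    mapBody (matCLM (c • A)) K = c • mapBody (matCLM A) K := by
  ext y
  constructor
  · rintro ⟨z, hz, rfl⟩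
    exact ⟨_, ⟨z, hz, rfl⟩, (matCLM_smul c A z).symm⟩
  · rintro ⟨_, ⟨z, hz, rfl⟩, rfl⟩
    exact ⟨z, hz, matCLM_smul c A z⟩

theorem mapBody_one (K : ConvexBody (Euc n)) : mapBody (matCLM 1) K = K := by
  ext y
  simp [mapBody, matCLM]

theorem supportFn_mapBody_matCLM (A : Matrix (Fin n) (Fin n) ℝ) (K : ConvexBody (Euc n))
    (x : Euc n) : supportFn (mapBody (matCLM A) K) x = supportFn K (matCLM A.transpose x) := by
  rw [supportFn_mapBody, adjoint_matCLM]

/-- In degree `n + 1`, equivariance under `SL(n)` together with homogeneity amounts to covariance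
under all linear maps of positive determinant. -/
theorem isCovariantValuation_supportFn_iff (hn : 0 < n)
    (Φ : ConvexBody (Euc n) → ConvexBody (Euc n)) :
    IsCovariantValuation (fun K => supportFn (Φ K)) ↔
      IsMinkowskiValuation Φ ∧ Continuous Φ ∧ IsSLEquivariant Φ ∧
        IsHomogeneousOfDegree ((n : ℝ) + 1) Φ := by
  have hpow : ∀ c : ℝ, 0 < c → c ^ ((n : ℝ) + 1) = c ^ (n + 1) := by
    intro c _
    exact_mod_cast Real.rpow_natCast c (n + 1)
  constructor
  · intro h
    refine ⟨fun K L U I hU hI => supportFn_injective ?_, ?_, fun φ K => supportFn_injective ?_,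
      fun c hc K => supportFn_injective ?_⟩
    · funext x
      rw [supportFn_add, supportFn_add]
      exact h.val K L U I hU hI x
    · refine continuous_iff_continuousAt.2 fun K => ?_
      refine Metric.tendsto_nhds.2 fun ε hε => ?_
      filter_upwards [h.cont K (ε / 2) (by linarith)] with L hL
      exact (dist_le_of_supportFn (by linarith) hL).trans_lt (by linarith)
    · funext x
      rw [supportFn_mapBody_matCLM]
      have := h.cov (φ : Matrix (Fin n) (Fin n) ℝ) (by simp) K x
      rwa [φ.det_coe, one_mul] at this
    · funext x
      have h1 := h.cov (c • 1) (by simp [hc]) K x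
      rw [smul_mapBody, mapBody_one] at h1
      rw [h1, supportFn_smul (by positivity), hpow c hc, Matrix.transpose_smul, matCLM_smul,
        supportFn_smul_right hc.le]
      simp [matCLM, pow_succ, mul_assoc]
  · rintro ⟨hval, hcont, hSL, hhom⟩
    refine ⟨fun K L U I hU hI x => ?_, fun K ε hε => ?_, fun K => continuous_supportFn _,
      fun K c hc x => supportFn_smul_right hc _ x, fun A hA K x => ?_⟩
    · rw [← supportFn_add, ← supportFn_add, hval K L U I hU hI]
    · have h1 := (Metric.tendsto_nhds.1 (hcont.tendsto K)) ε hε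
      filter_upwards [h1] with L hL x
      refine (abs_supportFn_sub_le _ _ x).trans ?_
      gcongr
    · set c : ℝ := A.det ^ ((n : ℝ)⁻¹) with hc
      have hc0 : 0 < c := Real.rpow_pos_of_pos hA _
      have hcn : c ^ n = A.det := Real.rpow_inv_natCast_pow hA.le hn.ne'
      have hdet : (c⁻¹ • A).det = 1 := by
        rw [Matrix.det_smul, Fintype.card_fin, inv_pow, hcn, inv_mul_cancel₀ hA.ne']
      have hA' : A = c • c⁻¹ • A := by rw [smul_smul, mul_inv_cancel₀ hc0.ne', one_smul]
      have h1 := hSL ⟨c⁻¹ • A, hdet⟩ K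
      change Φ (mapBody (matCLM (c⁻¹ • A)) K) = mapBody (matCLM (c⁻¹ • A)) (Φ K) at h1
      conv_lhs => rw [hA', smul_mapBody, hhom c hc0, h1]
      rw [supportFn_smul (by positivity), hpow c hc0, supportFn_mapBody_matCLM,
        Matrix.transpose_smul, matCLM_smul, supportFn_smul_right (by positivity), ← hcn, pow_succ]
      field_simp

/-! ### The convex hull with the origin -/

theorem mem_hullZero {K : ConvexBody (Euc n)} {x : Euc n} :
    x ∈ hullZero K ↔ ∃ t ∈ Set.Icc (0 : ℝ) 1, ∃ y ∈ (K : Set (Euc n)), t • y = x := by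
  rw [hullZero, convexHull_insert K.nonempty, K.convex.convexHull_eq]
  simp only [convexJoin_singleton_left, Set.mem_iUnion, segment_eq_image, smul_zero, zero_add,
    Set.mem_image, exists_prop]
  exact ⟨fun ⟨y, hy, t, ht, h⟩ => ⟨t, ht, y, hy, h⟩, fun ⟨t, ht, y, hy, h⟩ => ⟨y, hy, t, ht, h⟩⟩

/-- `K_o = conv ({0} ∪ K)` as a convex body. -/
def hullBody (K : ConvexBody (Euc n)) : ConvexBody (Euc n) where
  carrier := hullZero K
  convex' := convex_convexHull ℝ _
  isCompact' := by
    have h : hullZero K =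
        (fun p : ℝ × Euc n => p.1 • p.2) '' (Set.Icc (0 : ℝ) 1 ×ˢ (K : Set (Euc n))) := by
      ext x
      rw [mem_hullZero]
      constructor
      · rintro ⟨t, ht, y, hy, rfl⟩
        exact ⟨(t, y), ⟨ht, hy⟩, rfl⟩
      · rintro ⟨⟨t, y⟩, ⟨ht, hy⟩, rfl⟩
        exact ⟨t, ht, y, hy, rfl⟩
    rw [h]
    exact (isCompact_Icc.prod K.isCompact).image (by fun_prop)
  nonempty' := ⟨0, subset_convexHull ℝ _ (Set.mem_insert _ _)⟩

theorem coe_hullBody (K : ConvexBody (Euc n)) : (hullBody K : Set (Euc n)) = hullZero K := rfl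

theorem subset_hullZero (K : ConvexBody (Euc n)) : (K : Set (Euc n)) ⊆ hullZero K :=
  (Set.subset_insert _ _).trans (subset_convexHull ℝ _)

theorem mapBody_hullBody (f : Euc n →L[ℝ] Euc n) (K : ConvexBody (Euc n)) :
    mapBody f (hullBody K) = hullBody (mapBody f K) := by
  refine ConvexBody.ext ?_
  change f '' (convexHull ℝ (insert 0 (K : Set (Euc n)))) =
    convexHull ℝ (insert 0 (f '' (K : Set (Euc n))))
  rw [← f.coe_coe, f.toLinearMap.image_convexHull, Set.image_insert_eq, map_zero]

theorem dist_hullBody_le (K L : ConvexBody (Euc n)) :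
    dist (hullBody K) (hullBody L) ≤ dist K L := by
  have key : ∀ K L : ConvexBody (Euc n), ∀ x ∈ (hullBody K : Set (Euc n)),
      ∃ z ∈ (hullBody L : Set (Euc n)), dist x z ≤ dist K L := by
    intro K L x hx
    obtain ⟨t, ht, y, hy, rfl⟩ := mem_hullZero.1 hx
    obtain ⟨z, hz, h2⟩ := L.isCompact.exists_infDist_eq_dist L.nonempty y
    have h3 : dist y z ≤ dist K L := by
      rw [← h2]
      exact infDist_le_hausdorffDist_of_mem hy ConvexBody.hausdorffEDist_ne_top
    refine ⟨t • z, mem_hullZero.2 ⟨t, ht, z, hz, rfl⟩, ?_⟩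
    rw [dist_smul₀, Real.norm_of_nonneg ht.1]
    exact (mul_le_of_le_one_left dist_nonneg ht.2).trans h3
  refine hausdorffDist_le_of_mem_dist dist_nonneg (key K L) fun x hx => ?_
  rw [dist_comm K L]
  exact key L K x hx

theorem hullZero_union {K L U : ConvexBody (Euc n)}
    (hU : (U : Set (Euc n)) = (K : Set (Euc n)) ∪ (L : Set (Euc n))) :
    hullZero U = hullZero K ∪ hullZero L := by
  ext x
  simp only [Set.mem_union, mem_hullZero, hU]
  constructor
  · rintro ⟨t, ht, y, hy | hy, rfl⟩
    · exact Or.inl ⟨t, ht, y, hy, rfl⟩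
    · exact Or.inr ⟨t, ht, y, hy, rfl⟩
  · rintro (⟨t, ht, y, hy, rfl⟩ | ⟨t, ht, y, hy, rfl⟩)
    · exact ⟨t, ht, y, Or.inl hy, rfl⟩
    · exact ⟨t, ht, y, Or.inr hy, rfl⟩

/-- If a ray from the origin meets both `K` and `L`, the segment between the two points lies in
the convex set `K ∪ L`; being connected it meets `K ∩ L`. -/
theorem hullZero_inter {K L U I : ConvexBody (Euc n)}
    (hU : (U : Set (Euc n)) = (K : Set (Euc n)) ∪ (L : Set (Euc n)))
    (hI : (I : Set (Euc n)) = (K : Set (Euc n)) ∩ (L : Set (Euc n))) :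
    hullZero I = hullZero K ∩ hullZero L := by
  have sub : ∀ M N : ConvexBody (Euc n), (M : Set (Euc n)) ⊆ N → hullZero M ⊆ hullZero N :=
    fun M N h => convexHull_mono (Set.insert_subset_insert h)
  refine Set.Subset.antisymm
    (Set.subset_inter (sub _ _ (hI ▸ Set.inter_subset_left))
      (sub _ _ (hI ▸ Set.inter_subset_right))) ?_
  rintro x ⟨hxK, hxL⟩
  obtain ⟨s, hs, k, hk, hsk⟩ := mem_hullZero.1 hxK
  obtain ⟨t, ht, l, hl, htl⟩ := mem_hullZero.1 hxL
  have hseg : segment ℝ k l ⊆ (K : Set (Euc n)) ∪ (L : Set (Euc n)) := by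
    rw [← hU]
    exact U.convex.segment_subset (hU ▸ Or.inl hk) (hU ▸ Or.inr hl)
  obtain ⟨p, hp, hpKL⟩ := isPreconnected_closed_iff.1 (convex_segment k l).isPreconnected
    _ _ K.isClosed L.isClosed hseg ⟨k, left_mem_segment ℝ k l, hk⟩
    ⟨l, right_mem_segment ℝ k l, hl⟩
  have hpI : p ∈ (I : Set (Euc n)) := hI ▸ hpKL
  obtain ⟨a, b, ha, hb, hab, rfl⟩ := hp
  refine mem_hullZero.2 ?_
  rcases eq_or_lt_of_le hs.1 with h0 | hs0
  · exact ⟨0, ⟨le_rfl, zero_le_one⟩, _, hpI, by rw [← hsk, ← h0, zero_smul, zero_smul]⟩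
  rcases eq_or_lt_of_le ht.1 with h0 | ht0
  · exact ⟨0, ⟨le_rfl, zero_le_one⟩, _, hpI, by rw [← htl, ← h0, zero_smul, zero_smul]⟩
  -- `a k + b l = (a / s + b / t) x`
  have hk' : k = s⁻¹ • x := by rw [← hsk, smul_smul, inv_mul_cancel₀ hs0.ne', one_smul]
  have hl' : l = t⁻¹ • x := by rw [← htl, smul_smul, inv_mul_cancel₀ ht0.ne', one_smul]
  have h1 : (1 : ℝ) ≤ s⁻¹ := (one_le_inv₀ hs0).2 hs.2
  have h2 : (1 : ℝ) ≤ t⁻¹ := (one_le_inv₀ ht0).2 ht.2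
  have h3 : 1 ≤ a * s⁻¹ + b * t⁻¹ := by nlinarith
  refine ⟨(a * s⁻¹ + b * t⁻¹)⁻¹, ⟨by positivity, inv_le_one_of_one_le₀ h3⟩, _, hpI, ?_⟩
  rw [hk', hl', smul_smul, smul_smul, ← add_smul, smul_smul, inv_mul_cancel₀ (by linarith),
    one_smul]

theorem IsCovariantValuation.comp_hullBody {R : ConvexBody (Euc n) → Euc n → ℝ}
    (h : IsCovariantValuation R) : IsCovariantValuation (fun K => R (hullBody K)) where
  val K L U I hU hI x := h.val _ _ _ _ (hullZero_union hU) (hullZero_inter hU hI) x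
  cont K ε hε := by
    have hc : Continuous (hullBody (n := n)) :=
      (LipschitzWith.of_dist_le_mul (K := 1) fun K L => by
        simpa using dist_hullBody_le K L).continuous
    exact (hc.tendsto K).eventually (h.cont (hullBody K) ε hε)
  contRight K := h.contRight _
  hom K := h.hom _
  cov A hA K x := by
    rw [← mapBody_hullBody, h.cov A hA]

/-! ### Moment functionals -/

theorem det_matCLM (A : Matrix (Fin n) (Fin n) ℝ) : (matCLM A).det = A.det := by
  rw [ContinuousLinearMap.det, matCLM, Matrix.coe_toEuclideanCLM_eq_toEuclideanLin,
    Matrix.toEuclideanLin, Matrix.toLpLin_eq_toLin, LinearMap.det_toLin]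

theorem matCLM_mul_apply (A B : Matrix (Fin n) (Fin n) ℝ) (x : Euc n) :
    matCLM A (matCLM B x) = matCLM (A * B) x := by
  rw [matCLM, matCLM, matCLM, map_mul]
  rfl

theorem matCLM_injective {A : Matrix (Fin n) (Fin n) ℝ} (hA : A.det ≠ 0) :
    Function.Injective (matCLM A) := by
  refine Function.LeftInverse.injective (g := matCLM A⁻¹) fun x => ?_
  rw [matCLM_mul_apply, Matrix.nonsing_inv_mul _ (isUnit_iff_ne_zero.2 hA)]
  simp [matCLM]

/-- The integral `∫_K g(⟨x, y⟩) dy`. -/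
def momentFn (g : ℝ → ℝ) (K : ConvexBody (Euc n)) (x : Euc n) : ℝ :=
  ∫ y in (K : Set (Euc n)), g (inner ℝ x y)

theorem measurableSet_coe (K : ConvexBody (Euc n)) : MeasurableSet (K : Set (Euc n)) :=
  K.isClosed.measurableSet

theorem integrableOn_of_continuous {E : Type*} [NormedAddCommGroup E] {f : Euc n → E}
    (hf : Continuous f) (K : ConvexBody (Euc n)) : IntegrableOn f (K : Set (Euc n)) :=
  hf.continuousOn.integrableOn_compact K.isCompact

theorem eventually_mem_of_mem_interior {K : ConvexBody (Euc n)} {y : Euc n}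
    (hy : y ∈ interior (K : Set (Euc n))) :
    ∀ᶠ L : ConvexBody (Euc n) in 𝓝 K, y ∈ (L : Set (Euc n)) := by
  obtain ⟨r, hr, hball⟩ := nhds_basis_closedBall.mem_iff.1 (mem_interior_iff_mem_nhds.1 hy)
  filter_upwards [ball_mem_nhds K hr] with L hL
  obtain ⟨z, hz, h1⟩ := exists_supportFn_add_norm_sq_le L y
  set u := y - z with hu
  rcases eq_or_ne u 0 with h0 | h0
  · rwa [sub_eq_zero.1 h0]
  exfalso
  have hu0 : 0 < ‖u‖ := norm_pos_iff.2 h0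
  have h2 : y + (r / ‖u‖) • u ∈ (K : Set (Euc n)) := by
    apply hball
    rw [mem_closedBall, dist_eq_norm, add_sub_cancel_left, norm_smul, Real.norm_of_nonneg
      (by positivity), div_mul_cancel₀ _ hu0.ne']
  have h3 := inner_le_supportFn K u h2
  rw [inner_add_right, real_inner_smul_right, real_inner_self_eq_norm_sq] at h3
  have h4 : r / ‖u‖ * ‖u‖ ^ 2 = r * ‖u‖ := by field_simp
  have h5 := (abs_le.1 (abs_supportFn_sub_le L K u)).1
  have h6 : dist L K * ‖u‖ ≤ r * ‖u‖ := by
    gcongr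
    exact (mem_ball.1 hL).le
  nlinarith

theorem eventually_notMem_of_notMem {K : ConvexBody (Euc n)} {y : Euc n}
    (hy : y ∉ (K : Set (Euc n))) : ∀ᶠ L : ConvexBody (Euc n) in 𝓝 K, y ∉ (L : Set (Euc n)) := by
  have hpos : 0 < infDist y (K : Set (Euc n)) :=
    (K.isClosed.notMem_iff_infDist_pos K.nonempty).1 hy
  filter_upwards [ball_mem_nhds K hpos] with L hL hyL
  have h1 := infDist_le_hausdorffDist_of_mem hyL
    (ConvexBody.hausdorffEDist_ne_top (K := L) (L := K))
  exact (mem_ball.1 hL).not_ge h1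

/-- Since the boundary of a convex body is a null set, the symmetric difference of `L` and `K`
tends to zero in (first moment) measure as `L → K`. -/
theorem tendsto_integral_indicator_sub (K : ConvexBody (Euc n)) :
    Tendsto (fun L : ConvexBody (Euc n) => ∫ y : Euc n,
      |(L : Set (Euc n)).indicator (fun _ => (1 : ℝ)) y -
        (K : Set (Euc n)).indicator (fun _ => (1 : ℝ)) y| * ‖y‖) (𝓝 K) (𝓝 0) := by
  obtain ⟨C, hC⟩ := K.isBounded.exists_norm_le
  have hlim := tendsto_integral_filter_of_dominated_convergence (μ := (volume : Measure (Euc n)))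
    (l := 𝓝 K) (f := fun _ : Euc n => (0 : ℝ))
    (F := fun (L : ConvexBody (Euc n)) y => |(L : Set (Euc n)).indicator (fun _ => (1 : ℝ)) y -
        (K : Set (Euc n)).indicator (fun _ => (1 : ℝ)) y| * ‖y‖)
    ((closedBall (0 : Euc n) (C + 1)).indicator (fun y : Euc n => ‖y‖)) ?_ ?_ ?_ ?_
  · simpa using hlim
  · refine Eventually.of_forall fun L => Measurable.aestronglyMeasurable ?_
    have hm : ∀ M : ConvexBody (Euc n),
        Measurable ((M : Set (Euc n)).indicator fun _ => (1 : ℝ)) :=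
      fun M => measurable_const.indicator (measurableSet_coe M)
    exact ((hm L).sub (hm K)).norm.mul measurable_norm
  · filter_upwards [ball_mem_nhds K one_pos] with L hL
    refine Eventually.of_forall fun y => ?_
    rw [Real.norm_of_nonneg (by positivity)]
    by_cases hy : y ∈ closedBall (0 : Euc n) (C + 1)
    · rw [Set.indicator_of_mem hy]
      refine mul_le_of_le_one_left (norm_nonneg y) ?_
      classical
      simp only [Set.indicator_apply]
      split_ifs <;> norm_num
    · rw [Set.indicator_of_notMem hy]
      have hK : y ∉ (K : Set (Euc n)) := fun h => hy <| by
        rw [mem_closedBall_zero_iff]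
        linarith [hC y h]
      have hL' : y ∉ (L : Set (Euc n)) := fun h => hy <| by
        obtain ⟨z, hz, hd⟩ := exists_dist_lt_of_hausdorffDist_lt h (mem_ball.1 hL)
          ConvexBody.hausdorffEDist_ne_top
        rw [mem_closedBall_zero_iff]
        have h1 := norm_le_norm_add_norm_sub' y z
        rw [← dist_eq_norm] at h1
        linarith [hC z hz]
      rw [Set.indicator_of_notMem hK, Set.indicator_of_notMem hL']
      simp
  · rw [integrable_indicator_iff isClosed_closedBall.measurableSet]
    exact continuous_norm.continuousOn.integrableOn_compact (isCompact_closedBall _ _)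
  · have hfr : ∀ᵐ y : Euc n, y ∉ frontier (K : Set (Euc n)) :=
      measure_eq_zero_iff_ae_notMem.1 (K.convex.addHaar_frontier volume)
    filter_upwards [hfr] with y hy
    refine tendsto_const_nhds.congr' ?_
    by_cases hyK : y ∈ (K : Set (Euc n))
    · have hint : y ∈ interior (K : Set (Euc n)) := by
        by_contra hcon
        exact hy ⟨subset_closure hyK, hcon⟩
      filter_upwards [eventually_mem_of_mem_interior hint] with L hL
      rw [Set.indicator_of_mem hL, Set.indicator_of_mem hyK]
      simp
    · filter_upwards [eventually_notMem_of_notMem hyK] with L hL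
      rw [Set.indicator_of_notMem hL, Set.indicator_of_notMem hyK]
      simp

theorem isCovariantValuation_momentFn {g : ℝ → ℝ} (hg : ∀ s t, |g s - g t| ≤ |s - t|)
    (hg' : ∀ c t, 0 ≤ c → g (c * t) = c * g t) :
    IsCovariantValuation (momentFn (n := n) g) := by
  have hgc : Continuous g :=
    (LipschitzWith.of_dist_le_mul (K := 1) fun s t => by
      simpa [Real.dist_eq] using hg s t).continuous
  have hg0 : g 0 = 0 := by simpa using hg' 0 0 le_rfl
  have hc : ∀ x : Euc n, Continuous fun y : Euc n => g (inner ℝ x y) :=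
    fun x => hgc.comp (by fun_prop)
  have hind : ∀ (K : ConvexBody (Euc n)) (x : Euc n),
      Integrable ((K : Set (Euc n)).indicator fun y => g (inner ℝ x y)) := fun K x =>
    (integrable_indicator_iff (measurableSet_coe K)).2 (integrableOn_of_continuous (hc x) K)
  have hfn : ∀ (K : ConvexBody (Euc n)) (x : Euc n), momentFn g K x =
      ∫ y, (K : Set (Euc n)).indicator (fun y => g (inner ℝ x y)) y := fun K x =>
    (integral_indicator (measurableSet_coe K)).symm
  refine ⟨fun K L U I hU hI x => ?_, fun K ε hε => ?_, fun K => ?_, fun K c hc0 x => ?_,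
    fun A hA K x => ?_⟩
  · rw [hfn, hfn, hfn, hfn, ← integral_add (hind K x) (hind L x),
      ← integral_add (hind U x) (hind I x), hU, hI]
    congr 1
    funext y
    exact (congrFun (Set.indicator_union_add_inter (fun y : Euc n => g (inner ℝ x y))
      (K : Set (Euc n)) L) y).symm
  · filter_upwards [(tendsto_integral_indicator_sub K).eventually (gt_mem_nhds hε)] with L hL x
    have hint : Integrable fun y : Euc n => |(L : Set (Euc n)).indicator (fun _ => (1 : ℝ)) y -
        (K : Set (Euc n)).indicator (fun _ => (1 : ℝ)) y| * ‖y‖ := by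
      have h1 : ∀ M : ConvexBody (Euc n),
          Integrable ((M : Set (Euc n)).indicator fun y : Euc n => ‖y‖) := fun M =>
        (integrable_indicator_iff (measurableSet_coe M)).2
          (integrableOn_of_continuous continuous_norm M)
      refine ((h1 L).sub (h1 K)).norm.congr (Eventually.of_forall fun y => ?_)
      classical
      simp only [Pi.sub_apply, Set.indicator_apply]
      split_ifs <;> simp
    rw [hfn, hfn, ← integral_sub (hind L x) (hind K x), ← Real.norm_eq_abs]
    refine (norm_integral_le_integral_norm _).trans ?_
    calc ∫ y, ‖(L : Set (Euc n)).indicator (fun y => g (inner ℝ x y)) y -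
          (K : Set (Euc n)).indicator (fun y => g (inner ℝ x y)) y‖
        ≤ ∫ y : Euc n, ‖x‖ * (|(L : Set (Euc n)).indicator (fun _ => (1 : ℝ)) y -
          (K : Set (Euc n)).indicator (fun _ => (1 : ℝ)) y| * ‖y‖) := by
          refine integral_mono ((hind L x).sub (hind K x)).norm (hint.const_mul _) fun y => ?_
          have h2 : |g (inner ℝ x y)| ≤ ‖x‖ * ‖y‖ := by
            have := hg (inner ℝ x y) 0
            rw [hg0, sub_zero, sub_zero] at this
            exact this.trans (abs_real_inner_le_norm x y)
          classical
          simp only [Set.indicator_apply]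
          split_ifs <;> simp [h2]
      _ ≤ ε * ‖x‖ := by
          rw [integral_const_mul, mul_comm]
          gcongr
  · refine continuous_iff_continuousAt.2 fun x => ?_
    rw [ContinuousAt, Metric.tendsto_nhds]
    intro ε hε
    set N := ∫ y in (K : Set (Euc n)), ‖y‖ with hN
    have hN0 : 0 ≤ N := integral_nonneg fun y => norm_nonneg y
    filter_upwards [ball_mem_nhds x (show 0 < ε / (N + 1) by positivity)] with z hz
    rw [Real.dist_eq, momentFn, momentFn, ← integral_sub (integrableOn_of_continuous (hc z) K)
      (integrableOn_of_continuous (hc x) K), ← Real.norm_eq_abs]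
    refine (norm_integral_le_integral_norm _).trans_lt ?_
    calc ∫ y in (K : Set (Euc n)), ‖g (inner ℝ z y) - g (inner ℝ x y)‖
        ≤ ∫ y in (K : Set (Euc n)), ‖z - x‖ * ‖y‖ := by
          refine integral_mono (integrableOn_of_continuous ((hc z).sub (hc x)).norm K)
            (integrableOn_of_continuous (by fun_prop) K) fun y => ?_
          refine (hg _ _).trans ?_
          rw [← inner_sub_left]
          exact abs_real_inner_le_norm _ _
      _ = ‖z - x‖ * N := integral_const_mul _ _
      _ ≤ ε / (N + 1) * N := by
          gcongr
          rw [← dist_eq_norm]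
          exact (mem_ball.1 hz).le
      _ < ε := by
          rw [div_mul_eq_mul_div, div_lt_iff₀ (by positivity)]
          nlinarith
  · simp only [momentFn, real_inner_smul_left]
    rw [← integral_const_mul]
    exact integral_congr_ae (Eventually.of_forall fun y => hg' c _ hc0)
  · have h1 := integral_image_eq_integral_abs_det_fderiv_smul (volume : Measure (Euc n))
      (measurableSet_coe K) (fun z _ => (matCLM A).hasFDerivWithinAt)
      (matCLM_injective hA.ne').injOn (fun y => g (inner ℝ x y))
    rw [momentFn, momentFn, ← integral_const_mul]
    refine h1.trans (integral_congr_ae (Eventually.of_forall fun y => ?_))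
    simp only [det_matCLM, abs_of_pos hA, smul_eq_mul]
    rw [← adjoint_matCLM, ContinuousLinearMap.adjoint_inner_left]

theorem isCovariantValuation_momentFn_id : IsCovariantValuation (momentFn (n := n) fun t => t) :=
  isCovariantValuation_momentFn (fun _ _ => le_rfl) fun _ _ _ => rfl

theorem isCovariantValuation_momentFn_abs :
    IsCovariantValuation (momentFn (n := n) fun t => |t|) :=
  isCovariantValuation_momentFn (fun s t => abs_abs_sub_abs_le s t) fun c t hc => by
    rw [abs_mul, abs_of_nonneg hc]

theorem supportFn_combination {a₃ a₄ : ℝ} (a₁ a₂ : ℝ) (h₃ : 0 ≤ a₃) (h₄ : 0 ≤ a₄)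
    (K : ConvexBody (Euc n)) (x : Euc n) :
    supportFn (a₁ • momentVector K + a₂ • momentVectorStar K + a₃ • momentBody K +
        a₄ • momentBodyStar K) x =
      a₁ * momentFn (fun t => t) K x +
        a₂ * (momentFn (fun t => t) (hullBody K) x - momentFn (fun t => t) K x) +
        a₃ * momentFn (fun t => |t|) K x +
        a₄ * (momentFn (fun t => |t|) (hullBody K) x - momentFn (fun t => |t|) K x) := by
  have hdiff : ∀ f : Euc n → ℝ, Continuous f →
      ∫ y in hullZero K \ (K : Set (Euc n)), f y =
        (∫ y in (hullBody K : Set (Euc n)), f y) - ∫ y in (K : Set (Euc n)), f y := fun f hf => by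
    rw [← coe_hullBody, setIntegral_sdiff (measurableSet_coe K)
      (integrableOn_of_continuous hf (hullBody K)) (subset_hullZero K)]
  have hin : ∀ s : Set (Euc n), IntegrableOn (fun y : Euc n => y) s →
      inner ℝ (∫ y in s, y) x = ∫ y in s, inner ℝ x y := fun s hs => by
    rw [real_inner_comm, integral_inner hs]
  have hK := integrableOn_of_continuous (continuous_id (X := Euc n)) K
  have hK' := integrableOn_of_continuous (continuous_id (X := Euc n)) (hullBody K)
  rw [supportFn_add, supportFn_add, supportFn_add, supportFn_smul h₃, supportFn_smul h₄,
    supportFn_momentBody, supportFn_momentBodyStar, momentVector, momentVectorStar,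
    supportFn_smul_pointBody, supportFn_smul_pointBody, hin _ hK,
    hin (hullZero K \ (K : Set (Euc n)))
      (hK'.mono_set Set.sdiff_subset), hdiff _ (by fun_prop), hdiff _ (by fun_prop)]
  rfl

/-! ### Cutting by hyperplanes -/

open Classical in
/-- The extension of a function on convex bodies to all sets, with the value `0` at the sets that
are not convex bodies. Only its value `0` at the empty set matters: it spares case distinctions
when a hyperplane misses a body. -/
def extend (R : ConvexBody (Euc n) → Euc n → ℝ) (A : Set (Euc n)) (x : Euc n) : ℝ :=
  if h : Convex ℝ A ∧ IsCompact A ∧ A.Nonempty then R ⟨A, h.1, h.2.1, h.2.2⟩ x else 0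

section Extend

variable {R : ConvexBody (Euc n) → Euc n → ℝ}

theorem extend_coe (K : ConvexBody (Euc n)) (x : Euc n) :
    extend R (K : Set (Euc n)) x = R K x :=
  dif_pos ⟨K.convex, K.isCompact, K.nonempty⟩

theorem extend_empty (x : Euc n) : extend R ∅ x = 0 :=
  dif_neg fun h => Set.not_nonempty_empty h.2.2

theorem extend_eq_zero {A : Set (Euc n)} {x : Euc n}
    (h : ∀ K : ConvexBody (Euc n), (K : Set (Euc n)) = A → R K x = 0) : extend R A x = 0 := by
  unfold extend
  split_ifs with hA
  · exact h _ rfl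
  · rfl

theorem convex_setOf_inner_le (u : Euc n) (c : ℝ) : Convex ℝ {y : Euc n | inner ℝ u y ≤ c} :=
  convex_halfSpace_le (innerₗ (Euc n) u).isLinear c

theorem convex_setOf_le_inner (u : Euc n) (c : ℝ) : Convex ℝ {y : Euc n | c ≤ inner ℝ u y} :=
  convex_halfSpace_ge (innerₗ (Euc n) u).isLinear c

theorem isClosed_setOf_inner_le (u : Euc n) (c : ℝ) :
    IsClosed {y : Euc n | inner ℝ u y ≤ c} :=
  isClosed_le (by fun_prop) continuous_const

theorem isClosed_setOf_le_inner (u : Euc n) (c : ℝ) :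
    IsClosed {y : Euc n | c ≤ inner ℝ u y} :=
  isClosed_le continuous_const (by fun_prop)

namespace IsCovariantValuation

/-- The valuation property for the two parts into which a hyperplane cuts a body. -/
theorem extend_cut (h : IsCovariantValuation R) {A : Set (Euc n)} (hA : Convex ℝ A)
    (hA' : IsCompact A) (u : Euc n) (c : ℝ) (x : Euc n) :
    extend R (A ∩ {y | inner ℝ u y ≤ c}) x + extend R (A ∩ {y | c ≤ inner ℝ u y}) x =
      extend R A x + extend R (A ∩ {y | inner ℝ u y = c}) x := by
  set B := A ∩ {y | inner ℝ u y ≤ c} with hB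
  set C := A ∩ {y | c ≤ inner ℝ u y} with hC
  set D := A ∩ {y | inner ℝ u y = c} with hD
  have hBC : A = B ∪ C := by
    rw [hB, hC, ← Set.inter_union_distrib_left]
    refine (Set.inter_eq_left.2 fun y _ => ?_).symm
    exact le_total (inner ℝ u y) c
  have hBD : D = B ∩ C := by
    ext y
    simp only [hB, hC, hD, Set.mem_inter_iff, Set.mem_ofPred_eq]
    constructor
    · rintro ⟨h1, h2⟩
      exact ⟨⟨h1, h2.le⟩, h1, h2.ge⟩
    · rintro ⟨⟨h1, h2⟩, -, h3⟩
      exact ⟨h1, le_antisymm h2 h3⟩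
  rcases B.eq_empty_or_nonempty with hB0 | hB0
  · rw [hBD, hB0, Set.empty_inter, extend_empty, hBC, hB0, Set.empty_union, zero_add, add_zero]
  rcases C.eq_empty_or_nonempty with hC0 | hC0
  · rw [hBD, hC0, Set.inter_empty, extend_empty, hBC, hC0, Set.union_empty]
  have hBcl : IsClosed B := hA'.isClosed.inter (isClosed_setOf_inner_le u c)
  have hCcl : IsClosed C := hA'.isClosed.inter (isClosed_setOf_le_inner u c)
  have hD0 : D.Nonempty := by
    rw [hBD]
    obtain ⟨p, -, hp⟩ := isPreconnected_closed_iff.1 hA.isPreconnected B C hBcl hCcl hBC.le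
      (hB0.mono fun y hy => ⟨hy.1, hy⟩) (hC0.mono fun y hy => ⟨hy.1, hy⟩)
    exact ⟨p, hp⟩
  have hBc : Convex ℝ B := hA.inter (convex_setOf_inner_le u c)
  have hCc : Convex ℝ C := hA.inter (convex_setOf_le_inner u c)
  have hBk : IsCompact B := hA'.of_isClosed_subset hBcl Set.inter_subset_left
  have hCk : IsCompact C := hA'.of_isClosed_subset hCcl Set.inter_subset_left
  have hA0 : A.Nonempty := hB0.mono Set.inter_subset_left
  have hDc : Convex ℝ D := hBD ▸ hBc.inter hCc
  have hDk : IsCompact D := hBD ▸ hBk.inter hCk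
  let K : ConvexBody (Euc n) := ⟨B, hBc, hBk, hB0⟩
  let L : ConvexBody (Euc n) := ⟨C, hCc, hCk, hC0⟩
  let U : ConvexBody (Euc n) := ⟨A, hA, hA', hA0⟩
  let I : ConvexBody (Euc n) := ⟨D, hDc, hDk, hD0⟩
  have key := h.val K L U I hBC hBD x
  rw [← extend_coe (R := R), ← extend_coe (R := R), ← extend_coe (R := R),
    ← extend_coe (R := R)] at key
  exact key

/-- A covariant valuation vanishes on the bodies in a hyperplane through the origin: dilating by
`c` orthogonally to the hyperplane fixes the body and has determinant `c`, and `c → 0`. -/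
theorem eq_zero_of_inner_eq_zero (h : IsCovariantValuation R) {u : Euc n} (hu : u ≠ 0)
    {K : ConvexBody (Euc n)} (hK : ∀ y ∈ (K : Set (Euc n)), inner ℝ u y = 0) (x : Euc n) :
    R K x = 0 := by
  have hN : 0 < inner ℝ u u := real_inner_self_pos.2 hu
  have key : ∀ c : ℝ, 0 < c →
      R K x = c * R K (x + ((c - 1) / inner ℝ u u * inner ℝ u x) • u) := by
    intro c hc
    set s := (c - 1) / inner ℝ u u with hs
    set A : Matrix (Fin n) (Fin n) ℝ := 1 + s • Matrix.vecMulVec u u with hA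
    have happ : ∀ y, matCLM A y = y + (s * inner ℝ u y) • u := by
      intro y
      ext i
      rw [matCLM_apply]
      simp only [hA, Matrix.add_apply, Matrix.smul_apply, Matrix.vecMulVec_apply, add_mul,
        Finset.sum_add_distrib, Matrix.one_apply, PiLp.add_apply, PiLp.smul_apply, smul_eq_mul,
        PiLp.inner_apply, RCLike.inner_apply, conj_trivial]
      simp only [ite_mul, one_mul, zero_mul, Finset.sum_ite_eq, Finset.mem_univ, if_true]
      rw [Finset.mul_sum, Finset.sum_mul]
      congr 1
      exact Finset.sum_congr rfl fun j _ => by ring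
    have hdet : A.det = c := by
      have h1 : s • Matrix.vecMulVec (u : Fin n → ℝ) u =
          Matrix.replicateCol Unit (s • (u : Fin n → ℝ)) * Matrix.replicateRow Unit u := by
        rw [← Matrix.vecMulVec_eq, Matrix.smul_vecMulVec]
      have h2 : (u : Fin n → ℝ) ⬝ᵥ u = inner ℝ u u := by
        simp only [dotProduct, PiLp.inner_apply, RCLike.inner_apply, conj_trivial]
      rw [hA, h1, Matrix.det_one_add_replicateCol_mul_replicateRow, dotProduct_smul, h2, hs,
        smul_eq_mul, div_mul_cancel₀ _ hN.ne']
      ring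
    have hT : A.transpose = A := by
      rw [hA, Matrix.transpose_add, Matrix.transpose_one, Matrix.transpose_smul,
        Matrix.transpose_vecMulVec]
    have hmap : mapBody (matCLM A) K = K := by
      refine ConvexBody.ext ?_
      have h1 : Set.EqOn (matCLM A) id (K : Set (Euc n)) := fun y hy => by
        rw [happ, hK y hy, mul_zero, zero_smul, add_zero]
        rfl
      change matCLM A '' (K : Set (Euc n)) = K
      rw [h1.image_eq, Set.image_id]
    have h3 := h.cov A (hdet ▸ hc) K x
    rwa [hmap, hdet, hT, happ] at h3
  have hcont : Continuous fun c : ℝ =>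
      c * R K (x + ((c - 1) / inner ℝ u u * inner ℝ u x) • u) :=
    continuous_id.mul ((h.contRight K).comp (by fun_prop))
  have hlim := (hcont.tendsto 0).mono_left (nhdsWithin_le_nhds (s := Set.Ioi 0))
  rw [zero_mul] at hlim
  refine tendsto_nhds_unique (tendsto_const_nhds.congr' ?_) hlim
  filter_upwards [self_mem_nhdsWithin] with c hc
  exact key c hc

theorem extend_eq_zero_of_inner_eq_zero (h : IsCovariantValuation R) {u : Euc n} (hu : u ≠ 0)
    {A : Set (Euc n)} (hA : ∀ y ∈ A, inner ℝ u y = 0) (x : Euc n) : extend R A x = 0 :=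
  extend_eq_zero fun _ hK => h.eq_zero_of_inner_eq_zero hu (fun y hy => hA y (hK ▸ hy)) x

theorem extend_cut_zero (h : IsCovariantValuation R) {A : Set (Euc n)} (hA : Convex ℝ A)
    (hA' : IsCompact A) {u : Euc n} (hu : u ≠ 0) (x : Euc n) :
    extend R A x =
      extend R (A ∩ {y | inner ℝ u y ≤ 0}) x + extend R (A ∩ {y | 0 ≤ inner ℝ u y}) x := by
  rw [h.extend_cut hA hA' u 0 x, h.extend_eq_zero_of_inner_eq_zero hu
    (A := A ∩ {y | inner ℝ u y = 0}) (fun y hy => hy.2), add_zero]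

theorem extend_image (h : IsCovariantValuation R) {A : Matrix (Fin n) (Fin n) ℝ}
    (hA : 0 < A.det) (S : Set (Euc n)) (x : Euc n) (hS : Convex ℝ S) (hS' : IsCompact S) :
    extend R (matCLM A '' S) x = A.det * extend R S (matCLM A.transpose x) := by
  rcases S.eq_empty_or_nonempty with rfl | h0
  · rw [Set.image_empty, extend_empty, extend_empty, mul_zero]
  · have := h.cov A hA ⟨S, hS, hS', h0⟩ x
    rwa [← extend_coe (R := R), ← extend_coe (R := R)] at this

end IsCovariantValuation

end Extend

/-! ### Simplices and their dissection -/

/-- The set of the combinations `∑ cᵢ vᵢ` with `cᵢ ≥ 0` and `∑ cᵢ ∈ I`. For `I = [0, 1]` it is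
the simplex with vertices `0, v₁, …, vₙ`, for `I = {1}` its facet opposite to the origin. -/
def simplexSet (I : Set ℝ) (v : Fin n → Euc n) : Set (Euc n) :=
  {y | ∃ c : Fin n → ℝ, (∀ i, 0 ≤ c i) ∧ ∑ i, c i ∈ I ∧ y = ∑ i, c i • v i}

theorem convex_simplexSet {I : Set ℝ} (hI : Convex ℝ I) (v : Fin n → Euc n) :
    Convex ℝ (simplexSet I v) := by
  rintro _ ⟨c, hc, hcI, rfl⟩ _ ⟨d, hd, hdI, rfl⟩ a b ha hb hab
  refine ⟨fun i => a * c i + b * d i, fun i => ?_, ?_, ?_⟩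
  · have := hc i
    have := hd i
    positivity
  · rw [Finset.sum_add_distrib, ← Finset.mul_sum, ← Finset.mul_sum]
    exact hI hcI hdI ha hb hab
  · simp only [add_smul, Finset.sum_add_distrib, Finset.smul_sum, mul_smul]

theorem isCompact_simplexSet {I : Set ℝ} (hI : IsCompact I) (v : Fin n → Euc n) :
    IsCompact (simplexSet I v) := by
  obtain ⟨C, hC⟩ := hI.bddAbove
  have hcpt : IsCompact {c : Fin n → ℝ | (∀ i, 0 ≤ c i) ∧ ∑ i, c i ∈ I} := by
    refine (isCompact_Icc (a := (0 : Fin n → ℝ)) (b := fun _ => C)).of_isClosed_subset ?_ ?_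
    · exact (isClosed_Ici (a := (0 : Fin n → ℝ))).inter
        (hI.isClosed.preimage (f := fun c : Fin n → ℝ => ∑ i, c i) (by fun_prop))
    · rintro c ⟨hc, hcI⟩
      exact ⟨hc, fun i =>
        (Finset.single_le_sum (fun j _ => hc j) (Finset.mem_univ i)).trans (hC hcI)⟩
  have himg : simplexSet I v = (fun c : Fin n → ℝ => ∑ i, c i • v i) ''
      {c : Fin n → ℝ | (∀ i, 0 ≤ c i) ∧ ∑ i, c i ∈ I} := by
    ext y
    constructor
    · rintro ⟨c, hc, hcI, rfl⟩
      exact ⟨c, ⟨hc, hcI⟩, rfl⟩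
    · rintro ⟨c, ⟨hc, hcI⟩, rfl⟩
      exact ⟨c, hc, hcI, rfl⟩
  rw [himg]
  exact hcpt.image (by fun_prop)

theorem inner_sum_smul (u : Euc n) (c : Fin n → ℝ) (v : Fin n → Euc n) :
    inner ℝ u (∑ i, c i • v i) = ∑ i, c i * inner ℝ u (v i) := by
  simp only [inner_sum, real_inner_smul_right]

theorem simplexSet_inner_eq_zero {I : Set ℝ} {v : Fin n → Euc n} {u : Euc n}
    (h : ∀ i, inner ℝ u (v i) = 0) {y : Euc n} (hy : y ∈ simplexSet I v) : inner ℝ u y = 0 := by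
  obtain ⟨c, -, -, rfl⟩ := hy
  simp [inner_sum_smul, h]

theorem sum_smul_update (c : Fin n → ℝ) (v : Fin n → Euc n) (b : Fin n) (w : Euc n) :
    ∑ i, c i • Function.update v b w i = (∑ i, c i • v i) + c b • (w - v b) := by
  have h : ∀ i, c i • Function.update v b w i =
      c i • v i + if i = b then c b • (w - v b) else 0 := by
    intro i
    by_cases hi : i = b
    · subst hi
      simp [smul_sub]
    · simp [hi]
  simp only [h, Finset.sum_add_distrib, Finset.sum_ite_eq', Finset.mem_univ, if_true]

/-- The hyperplane through all vertices but `v a` and `v b` and through a point `w` of the edge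
`[v a, v b]` cuts off the simplex in which `w` replaces `v b`. -/
theorem simplexSet_inter_eq {I : Set ℝ} {v : Fin n → Euc n} {a b : Fin n} (hab : a ≠ b)
    {s t : ℝ} (hs : 0 < s) (ht : 0 < t) (hst : s + t = 1) {u : Euc n}
    (hu : ∀ i, i ≠ a → i ≠ b → inner ℝ u (v i) = 0)
    (hw : inner ℝ u (s • v a + t • v b) = 0) (ha : 0 < inner ℝ u (v a)) :
    simplexSet I v ∩ {y | 0 ≤ inner ℝ u y} =
      simplexSet I (Function.update v b (s • v a + t • v b)) := by
  have hwb : s • v a + t • v b - v b = s • (v a - v b) := by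
    have : t = 1 - s := by linarith
    rw [this]
    module
  have hsum : ∀ (c : Fin n → ℝ) (r : ℝ) (p q : Fin n),
      ∑ i, (c i + r * ((if i = p then 1 else 0) - if i = q then 1 else 0)) = ∑ i, c i := by
    intro c r p q
    simp [Finset.sum_add_distrib, ← Finset.mul_sum]
  have hsumv : ∀ (c : Fin n → ℝ) (r : ℝ) (p q : Fin n),
      ∑ i, (c i + r * ((if i = p then 1 else 0) - if i = q then 1 else 0)) • v i =
        (∑ i, c i • v i) + r • (v p - v q) := by
    intro c r p q
    simp [add_smul, Finset.sum_add_distrib, mul_smul, ← Finset.smul_sum, sub_smul, ite_smul]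
  have hvb : t * inner ℝ u (v b) = -(s * inner ℝ u (v a)) := by
    rw [inner_add_right, real_inner_smul_right, real_inner_smul_right] at hw
    linarith
  ext y
  constructor
  · rintro ⟨⟨c, hc, hcI, rfl⟩, hy⟩
    have hy' : s * c b ≤ t * c a := by
      rw [Set.mem_ofPred_eq, inner_sum_smul, Fintype.sum_eq_add a b hab
        (fun i hi => by rw [hu i hi.1 hi.2, mul_zero])] at hy
      have h1 : t * (c a * inner ℝ u (v a) + c b * inner ℝ u (v b)) =
          inner ℝ u (v a) * (t * c a - s * c b) := by linear_combination c b * hvb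
      have h2 : 0 ≤ inner ℝ u (v a) * (t * c a - s * c b) := h1 ▸ mul_nonneg ht.le hy
      linarith [nonneg_of_mul_nonneg_right h2 ha]
    refine ⟨fun i => c i + (s * c b / t) *
      ((if i = b then 1 else 0) - if i = a then 1 else 0), fun i => ?_, ?_, ?_⟩
    · have h0 : 0 ≤ s * c b / t := by
        have := hc b
        positivity
      by_cases hib : i = b
      · subst hib
        simp only [if_true, hab.symm, if_false, sub_zero, mul_one]
        linarith [hc i]
      · by_cases hia : i = a
        · subst hia
          have h3 : s * c b / t ≤ c i := by
            rw [div_le_iff₀ ht]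
            linarith
          simp only [hib, if_false, if_true]
          linarith
        · simp only [hib, hia, if_false, sub_zero, mul_zero, add_zero]
          exact hc i
    · rw [hsum]
      exact hcI
    · rw [sum_smul_update, hsumv, hwb]
      have h4 : c b + s * c b / t = c b / t := by
        rw [eq_div_iff ht.ne', add_mul, div_mul_cancel₀ _ ht.ne']
        linear_combination c b * hst
      simp only [if_true, hab.symm, if_false, sub_zero, mul_one, h4]
      module
  · rintro ⟨c, hc, hcI, rfl⟩
    refine ⟨⟨fun i => c i + (s * c b) *
      ((if i = a then 1 else 0) - if i = b then 1 else 0), fun i => ?_, ?_, ?_⟩, ?_⟩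
    · have h0 : 0 ≤ s * c b := mul_nonneg hs.le (hc b)
      by_cases hib : i = b
      · subst hib
        simp only [if_true, hab.symm, if_false]
        have : 0 ≤ t * c i := mul_nonneg ht.le (hc i)
        nlinarith
      · by_cases hia : i = a
        · subst hia
          simp only [hib, if_false, if_true]
          linarith [hc i]
        · simp only [hib, hia, if_false, sub_zero, mul_zero, add_zero]
          exact hc i
    · rw [hsum]
      exact hcI
    · rw [sum_smul_update, hsumv, hwb]
      module
    · rw [Set.mem_ofPred_eq, inner_sum_smul]
      refine Finset.sum_nonneg fun i _ => mul_nonneg (hc i) ?_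
      by_cases hib : i = b
      · subst hib
        rw [Function.update_self, hw]
      · rw [Function.update_of_ne hib]
        by_cases hia : i = a
        · exact hia ▸ ha.le
        · exact (hu i hia hib).ge

theorem exists_ne_zero_inner_eq_zero {ι : Type*} [Fintype ι] (f : ι → Euc n)
    (hcard : Fintype.card ι < n) : ∃ u : Euc n, u ≠ 0 ∧ ∀ i, inner ℝ u (f i) = 0 := by
  have hne : (Submodule.span ℝ (Set.range f))ᗮ ≠ ⊥ := by
    intro hbot
    rw [Submodule.orthogonal_eq_bot_iff] at hbot
    have h1 : (Set.range f).finrank ℝ = n := by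
      rw [Set.finrank, hbot, finrank_top, finrank_euclideanSpace_fin]
    have h2 := finrank_range_le_card (R := ℝ) f
    omega
  obtain ⟨u, hu, hu0⟩ := Submodule.exists_mem_ne_zero_of_ne_bot hne
  refine ⟨u, hu0, fun i => ?_⟩
  rw [real_inner_comm]
  exact (Submodule.mem_orthogonal _ _).1 hu _ (Submodule.subset_span ⟨i, rfl⟩)

/-- A covariant valuation is additive when a simplex is cut at a point of an edge. The cutting
hyperplane contains the origin, so its section does not contribute; the closed convex set `Q` goes
along for the cuts by half-spaces. -/
theorem IsCovariantValuation.extend_simplexSet_cut {R : ConvexBody (Euc n) → Euc n → ℝ}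
    (h : IsCovariantValuation R) {I : Set ℝ} (hI : IsCompact I) (hI' : Convex ℝ I)
    {Q : Set (Euc n)} (hQ : IsClosed Q) (hQ' : Convex ℝ Q) (v : Fin n → Euc n) {a b : Fin n}
    (hab : a ≠ b) {s t : ℝ} (hs : 0 < s) (ht : 0 < t) (hst : s + t = 1) (x : Euc n) :
    extend R (simplexSet I v ∩ Q) x =
      extend R (simplexSet I (Function.update v b (s • v a + t • v b)) ∩ Q) x +
        extend R (simplexSet I (Function.update v a (s • v a + t • v b)) ∩ Q) x := by
  set w := s • v a + t • v b with hw
  have hcard : Fintype.card {i : Fin n // i ≠ a} < n := by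
    rw [Fintype.card_subtype_compl, Fintype.card_fin, Fintype.card_unique]
    have := a.pos
    omega
  obtain ⟨u, hu0, hu⟩ := exists_ne_zero_inner_eq_zero
    (fun i : {i : Fin n // i ≠ a} => Function.update v b w i) hcard
  have huw : inner ℝ u w = 0 := by simpa using hu ⟨b, hab.symm⟩
  have hui : ∀ i, i ≠ a → i ≠ b → inner ℝ u (v i) = 0 := fun i hia hib => by
    simpa [hib] using hu ⟨i, hia⟩
  have hcv := (convex_simplexSet hI' v).inter hQ'
  have hck := (isCompact_simplexSet hI v).inter_right hQ
  have hcomm : ∀ S : Set (Euc n), simplexSet I v ∩ Q ∩ S = simplexSet I v ∩ S ∩ Q :=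
    fun S => Set.inter_right_comm _ _ _
  -- the case `0 < ⟨u, v a⟩`, up to replacing `u` by `-u`
  have main : ∀ u : Euc n, u ≠ 0 → inner ℝ u w = 0 →
      (∀ i, i ≠ a → i ≠ b → inner ℝ u (v i) = 0) → 0 < inner ℝ u (v a) →
      extend R (simplexSet I v ∩ Q) x = extend R (simplexSet I (Function.update v b w) ∩ Q) x +
        extend R (simplexSet I (Function.update v a w) ∩ Q) x := by
    intro u hu0 huw hui hpos
    have hw' : w = t • v b + s • v a := by rw [hw, add_comm]
    have h1 := simplexSet_inter_eq (I := I) hab hs ht hst hui huw hpos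
    have hb : 0 < inner ℝ (-u) (v b) := by
      rw [hw, inner_add_right, real_inner_smul_right, real_inner_smul_right] at huw
      rw [inner_neg_left]
      have : 0 < s * inner ℝ u (v a) := mul_pos hs hpos
      by_contra! hcon
      have : 0 ≤ t * inner ℝ u (v b) := mul_nonneg ht.le (by linarith)
      linarith
    have h2 := simplexSet_inter_eq (I := I) (v := v) hab.symm ht hs (by linarith) (u := -u)
      (fun i hib hia => by rw [inner_neg_left, hui i hia hib, neg_zero])
      (by rw [← hw', inner_neg_left, huw, neg_zero]) hb
    rw [← hw'] at h2
    have h3 : {y : Euc n | 0 ≤ inner ℝ (-u) y} = {y | inner ℝ u y ≤ 0} := by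
      ext y
      simp [inner_neg_left]
    rw [h.extend_cut_zero hcv hck hu0, hcomm, hcomm, h1, ← h3, h2, add_comm]
  rcases lt_trichotomy (inner ℝ u (v a)) 0 with hneg | hzero | hpos
  · refine main (-u) (neg_ne_zero.2 hu0) ?_ ?_ ?_
    · rw [inner_neg_left, huw, neg_zero]
    · intro i hia hib
      rw [inner_neg_left, hui i hia hib, neg_zero]
    · rw [inner_neg_left]
      linarith
  · -- all the vertices lie in the hyperplane orthogonal to `u`
    have hvb : inner ℝ u (v b) = 0 := by
      rw [hw, inner_add_right, real_inner_smul_right, real_inner_smul_right, hzero, mul_zero,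
        zero_add] at huw
      exact (mul_eq_zero.1 huw).resolve_left ht.ne'
    have hv : ∀ i, inner ℝ u (v i) = 0 := fun i => by
      by_cases hia : i = a
      · rw [hia, hzero]
      · by_cases hib : i = b
        · rw [hib, hvb]
        · exact hui i hia hib
    have hup : ∀ j i, inner ℝ u (Function.update v j w i) = 0 := fun j i => by
      by_cases hij : i = j
      · rw [hij, Function.update_self, huw]
      · rw [Function.update_of_ne hij, hv]
    rw [h.extend_eq_zero_of_inner_eq_zero hu0 fun y hy => simplexSet_inner_eq_zero hv hy.1,
      h.extend_eq_zero_of_inner_eq_zero hu0 fun y hy => simplexSet_inner_eq_zero (hup b) hy.1,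
      h.extend_eq_zero_of_inner_eq_zero hu0 fun y hy => simplexSet_inner_eq_zero (hup a) hy.1,
      add_zero]
  · exact main u hu0 huw hui hpos

/-! ### The functional equation on the standard simplex -/

section MaximumPrinciple

variable {G : (Fin n → ℝ) → ℝ}

/-- In the functional equation `hcut` the value of `G` at `x` is an average of two values at points
of the same cube, so a maximum over the cube propagates until all coordinates agree. -/
theorem le_zero_of_cut_equation (hG : Continuous G)
    (hcut : ∀ a b : Fin n, a ≠ b → ∀ s t : ℝ, 0 < s → 0 < t → s + t = 1 → ∀ x : Fin n → ℝ,
      G x = t * G (Function.update x b (s * x a + t * x b)) +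
        s * G (Function.update x a (s * x a + t * x b)))
    (hdiag : ∀ r : ℝ, G (fun _ => r) = 0) (x : Fin n → ℝ) : G x ≤ 0 := by
  rcases Nat.eq_zero_or_pos n with rfl | hn
  · rw [show x = fun _ => 0 from Subsingleton.elim _ _, hdiag]
  set Q : Set (Fin n → ℝ) := Set.Icc (fun _ => -‖x‖) (fun _ => ‖x‖) with hQ
  have hxQ : x ∈ Q :=
    ⟨fun i => (abs_le.1 (norm_le_pi_norm x i)).1, fun i => (abs_le.1 (norm_le_pi_norm x i)).2⟩
  obtain ⟨z₀, hz₀, hmax⟩ := isCompact_Icc.exists_isMaxOn ⟨x, hxQ⟩ hG.continuousOn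
  have hle : ∀ y ∈ Q, G y ≤ G z₀ := hmax
  have hupd : ∀ z ∈ Q, ∀ a b j : Fin n, ∀ s t : ℝ, 0 ≤ s → 0 ≤ t → s + t = 1 →
      Function.update z j (s * z a + t * z b) ∈ Q := by
    intro z hz a b j s t hs ht hst
    have hmem : s * z a + t * z b ∈ Set.Icc (-‖x‖) ‖x‖ :=
      convex_Icc (-‖x‖) ‖x‖ ⟨hz.1 a, hz.2 a⟩ ⟨hz.1 b, hz.2 b⟩ hs ht hst
    refine ⟨fun i => ?_, fun i => ?_⟩ <;> by_cases hij : i = j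
    · subst hij
      rw [Function.update_self]
      exact hmem.1
    · rw [Function.update_of_ne hij]
      exact hz.1 i
    · subst hij
      rw [Function.update_self]
      exact hmem.2
    · rw [Function.update_of_ne hij]
      exact hz.2 i
  have step : ∀ z ∈ Q, G z₀ ≤ G z → ∀ a b : Fin n, a ≠ b →
      Function.update z b (z a) ∈ Q ∧ G z₀ ≤ G (Function.update z b (z a)) := by
    intro z hz hGz a b hab
    refine ⟨by simpa using hupd z hz a b b 1 0 zero_le_one le_rfl (add_zero 1), ?_⟩
    have hlim : Tendsto (fun s : ℝ => G (Function.update z b (s * z a + (1 - s) * z b)))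
        (𝓝[<] 1) (𝓝 (G (Function.update z b (z a)))) := by
      have hc : Continuous fun s : ℝ => G (Function.update z b (s * z a + (1 - s) * z b)) :=
        hG.comp (continuous_const.update b (by fun_prop))
      have := (hc.tendsto 1).mono_left (nhdsWithin_le_nhds (s := Set.Iio 1))
      simpa using this
    refine ge_of_tendsto hlim ?_
    filter_upwards [Ioo_mem_nhdsLT (show (0 : ℝ) < 1 by norm_num)] with s hs
    have hs' : 0 < 1 - s := by linarith [hs.2]
    have h1 := hcut a b hab s (1 - s) hs.1 hs' (by ring) z
    have h2 := hle _ (hupd z hz a b a s (1 - s) hs.1.le hs'.le (by ring))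
    have h3 := mul_le_mul_of_nonneg_left h2 hs.1.le
    refine le_of_mul_le_mul_left ?_ hs'
    linarith
  let a : Fin n := ⟨0, hn⟩
  have hall : ∀ F : Finset (Fin n), ∃ z ∈ Q, G z₀ ≤ G z ∧ ∀ i ∈ F, z i = z a := by
    intro F
    induction F using Finset.induction_on with
    | empty => exact ⟨z₀, hz₀, le_rfl, by simp⟩
    | insert b F hb ih =>
      obtain ⟨z, hz, hGz, hF⟩ := ih
      by_cases hab : a = b
      · refine ⟨z, hz, hGz, fun i hi => ?_⟩
        rcases Finset.mem_insert.1 hi with rfl | hi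
        · rw [hab]
        · exact hF i hi
      · obtain ⟨h1, h2⟩ := step z hz hGz a b hab
        refine ⟨_, h1, h2, fun i hi => ?_⟩
        rw [Function.update_of_ne hab]
        rcases Finset.mem_insert.1 hi with rfl | hi
        · rw [Function.update_self]
        · rw [Function.update_of_ne (fun h : i = b => hb (h ▸ hi)), hF i hi]
  obtain ⟨z, -, hGz, hz⟩ := hall Finset.univ
  rw [show z = fun _ => z a from funext fun i => hz i (Finset.mem_univ i), hdiag] at hGz
  exact (hle x hxQ).trans hGz

theorem eq_zero_of_cut_equation (hG : Continuous G)
    (hcut : ∀ a b : Fin n, a ≠ b → ∀ s t : ℝ, 0 < s → 0 < t → s + t = 1 → ∀ x : Fin n → ℝ,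
      G x = t * G (Function.update x b (s * x a + t * x b)) +
        s * G (Function.update x a (s * x a + t * x b)))
    (hdiag : ∀ r : ℝ, G (fun _ => r) = 0) (x : Fin n → ℝ) : G x = 0 := by
  refine le_antisymm (le_zero_of_cut_equation hG hcut hdiag x) ?_
  have := le_zero_of_cut_equation (G := fun y => -G y) hG.neg
    (fun a b hab s t hs ht hst y => by
      rw [hcut a b hab s t hs ht hst y]
      ring)
    (fun r => by rw [hdiag, neg_zero]) x
  linarith

end MaximumPrinciple

/-- The standard basis of Euclidean space. -/
def stdVec (i : Fin n) : Euc n := EuclideanSpace.single i 1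

/-- The vector with all coordinates equal to `r`. -/
def constVec (r : ℝ) : Euc n := WithLp.toLp 2 fun _ => r

/-- The matrix with columns `v i`. -/
def colMatrix (v : Fin n → Euc n) : Matrix (Fin n) (Fin n) ℝ := Matrix.of fun i j => v j i

theorem matCLM_colMatrix_sum (v : Fin n → Euc n) (c : Fin n → ℝ) :
    matCLM (colMatrix v) (∑ j, c j • stdVec j) = ∑ j, c j • v j := by
  rw [map_sum]
  refine Finset.sum_congr rfl fun j _ => ?_
  rw [map_smul]
  congr 1
  ext i
  rw [matCLM_apply]
  simp [stdVec, colMatrix]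

theorem matCLM_colMatrix_transpose (v : Fin n → Euc n) (x : Euc n) :
    matCLM (colMatrix v).transpose x = WithLp.toLp 2 fun i => inner ℝ (v i) x := by
  ext i
  rw [matCLM_apply]
  simp [colMatrix, PiLp.inner_apply, mul_comm]

theorem simplexSet_eq_image (I : Set ℝ) (v : Fin n → Euc n) :
    simplexSet I v = matCLM (colMatrix v) '' simplexSet I stdVec := by
  ext y
  constructor
  · rintro ⟨c, hc, hcI, rfl⟩
    exact ⟨_, ⟨c, hc, hcI, rfl⟩, matCLM_colMatrix_sum v c⟩
  · rintro ⟨_, ⟨c, hc, hcI, rfl⟩, rfl⟩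
    exact ⟨c, hc, hcI, matCLM_colMatrix_sum v c⟩

theorem simplexSet_comp_perm (I : Set ℝ) (v : Fin n → Euc n) (σ : Equiv.Perm (Fin n)) :
    simplexSet I (v ∘ σ) = simplexSet I v := by
  have key : ∀ (v : Fin n → Euc n) (σ : Equiv.Perm (Fin n)),
      simplexSet I v ⊆ simplexSet I (v ∘ σ) := by
    rintro v σ _ ⟨c, hc, hcI, rfl⟩
    refine ⟨c ∘ σ, fun i => hc _, ?_, ?_⟩
    · rwa [← Equiv.sum_comp σ c] at hcI
    · exact (Equiv.sum_comp σ fun i => c i • v i).symm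
  refine Set.Subset.antisymm ?_ (key v σ)
  have := key (v ∘ σ) σ⁻¹
  rwa [Function.comp_assoc, ← Equiv.Perm.coe_mul, mul_inv_cancel, Equiv.Perm.coe_one,
    Function.comp_id] at this

theorem det_colMatrix_update (b : Fin n) (w : Euc n) :
    (colMatrix (Function.update stdVec b w)).det = w b := by
  have h : colMatrix (Function.update stdVec b w) = Matrix.updateCol 1 b w := by
    ext i j
    rw [Matrix.updateCol_apply]
    by_cases hj : j = b
    · subst hj
      simp [colMatrix]
    · simp [colMatrix, hj, stdVec, Matrix.one_apply]
  rw [h, ← Matrix.cramer_apply, Matrix.cramer_one]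
  rfl

namespace IsCovariantValuation

variable {R : ConvexBody (Euc n) → Euc n → ℝ} {I : Set ℝ}

theorem continuous_extend (h : IsCovariantValuation R) (A : Set (Euc n)) :
    Continuous (extend R A) := by
  unfold extend
  split_ifs with hA
  · exact h.contRight _
  · exact continuous_const

theorem extend_smul (h : IsCovariantValuation R) (A : Set (Euc n)) {c : ℝ} (hc : 0 ≤ c)
    (x : Euc n) : extend R A (c • x) = c * extend R A x := by
  unfold extend
  split_ifs with hA
  · exact h.hom _ c hc x
  · rw [mul_zero]

theorem extend_constVec (h : IsCovariantValuation R) {A : Set (Euc n)}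
    (h1 : extend R A (constVec 1) = 0) (h2 : extend R A (constVec (-1)) = 0) (r : ℝ) :
    extend R A (constVec r) = 0 := by
  rcases le_total 0 r with hr | hr
  · have : (constVec r : Euc n) = r • constVec 1 := by
      ext i
      simp [constVec]
    rw [this, h.extend_smul A hr, h1, mul_zero]
  · have : (constVec r : Euc n) = (-r) • constVec (-1) := by
      ext i
      simp [constVec]
    rw [this, h.extend_smul A (neg_nonneg.2 hr), h2, mul_zero]

theorem extend_simplexSet (h : IsCovariantValuation R) (hI : IsCompact I) (hI' : Convex ℝ I)
    {v : Fin n → Euc n} (hv : 0 < (colMatrix v).det) (x : Euc n) :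
    extend R (simplexSet I v) x = (colMatrix v).det *
      extend R (simplexSet I stdVec) (WithLp.toLp 2 fun i => inner ℝ (v i) x) := by
  rw [simplexSet_eq_image, h.extend_image hv _ _ (convex_simplexSet hI' _)
    (isCompact_simplexSet hI _), matCLM_colMatrix_transpose]

/-- On the standard simplex a covariant valuation satisfies the functional equation of
`eq_zero_of_cut_equation`. -/
theorem extend_simplexSet_stdVec_eq_zero (h : IsCovariantValuation R) (hI : IsCompact I)
    (hI' : Convex ℝ I) (h1 : extend R (simplexSet I stdVec) (constVec 1) = 0)
    (h2 : extend R (simplexSet I stdVec) (constVec (-1)) = 0) (x : Euc n) :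
    extend R (simplexSet I stdVec) x = 0 := by
  have hinner : ∀ (i : Fin n) (x : Euc n), inner ℝ (stdVec i) x = x i := fun i x => by
    simp [stdVec, EuclideanSpace.inner_single_left]
  refine eq_zero_of_cut_equation
    (G := fun x : Fin n → ℝ => extend R (simplexSet I stdVec) (WithLp.toLp 2 x))
    ((h.continuous_extend _).comp (by fun_prop)) ?_ (h.extend_constVec h1 h2) x
  intro a b hab s t hs ht hst x
  have hcut := h.extend_simplexSet_cut hI hI' isClosed_univ convex_univ stdVec hab hs ht hst
    (WithLp.toLp 2 x)
  simp only [Set.inter_univ] at hcut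
  set w : Euc n := s • stdVec a + t • stdVec b with hw
  have hwa : w a = s := by simp [hw, stdVec, hab]
  have hwb : w b = t := by simp [hw, stdVec, hab.symm]
  have hup : ∀ j, (fun i => inner ℝ (Function.update stdVec j w i) (WithLp.toLp 2 x : Euc n)) =
      Function.update x j (s * x a + t * x b) := by
    intro j
    funext i
    by_cases hij : i = j
    · subst hij
      rw [Function.update_self, Function.update_self, hw, inner_add_left, real_inner_smul_left,
        real_inner_smul_left, hinner, hinner]
    · rw [Function.update_of_ne hij, Function.update_of_ne hij, hinner]
  rw [h.extend_simplexSet hI hI' (v := Function.update stdVec b w)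
      (by rwa [det_colMatrix_update, hwb]),
    h.extend_simplexSet hI hI' (v := Function.update stdVec a w)
      (by rwa [det_colMatrix_update, hwa]),
    det_colMatrix_update, det_colMatrix_update, hwa, hwb, hup, hup] at hcut
  exact hcut

theorem extend_simplexSet_eq_zero (h : IsCovariantValuation R) (hn : 2 ≤ n) (hI : IsCompact I)
    (hI' : Convex ℝ I) (h1 : extend R (simplexSet I stdVec) (constVec 1) = 0)
    (h2 : extend R (simplexSet I stdVec) (constVec (-1)) = 0) (v : Fin n → Euc n) (x : Euc n) :
    extend R (simplexSet I v) x = 0 := by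
  have hstd := h.extend_simplexSet_stdVec_eq_zero hI hI' h1 h2
  rcases lt_trichotomy (colMatrix v).det 0 with hneg | hzero | hpos
  · let σ : Equiv.Perm (Fin n) := Equiv.swap ⟨0, by omega⟩ ⟨1, by omega⟩
    have hdet : 0 < (colMatrix (v ∘ σ)).det := by
      have h3 : colMatrix (v ∘ σ) = (colMatrix v).submatrix id σ := rfl
      rw [h3, Matrix.det_permute', Equiv.Perm.sign_swap (by simp)]
      simpa using hneg
    rw [← simplexSet_comp_perm I v σ, h.extend_simplexSet hI hI' hdet, hstd, mul_zero]
  · obtain ⟨u, hu0, hu⟩ := Matrix.exists_vecMul_eq_zero_iff.2 hzero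
    refine h.extend_eq_zero_of_inner_eq_zero (u := WithLp.toLp 2 u) (fun h0 => hu0 ?_)
      (fun y hy => simplexSet_inner_eq_zero (v := v) (fun i => ?_) hy) x
    · simpa using h0
    · have := congrFun hu i
      simpa [Matrix.vecMul, dotProduct, colMatrix, PiLp.inner_apply, mul_comm] using this
  · rw [h.extend_simplexSet hI hI' hpos, hstd, mul_zero]

end IsCovariantValuation

/-! ### Simplices cut by half-spaces -/

/-- A property of `n`-tuples of points holds for all tuples if it holds for those lying on one side
of the hyperplane `⟨u, y⟩ = c` and is inherited from the two tuples that arise when a point of a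
segment `[v a, v b]` replaces `v a` or `v b`: one may cut at the points where the hyperplane meets
an edge. -/
theorem edge_induction (u : Euc n) (c : ℝ) {P : (Fin n → Euc n) → Prop}
    (hcut : ∀ (v : Fin n → Euc n) (a b : Fin n) (s t : ℝ), a ≠ b → 0 < s → 0 < t → s + t = 1 →
      P (Function.update v b (s • v a + t • v b)) → P (Function.update v a (s • v a + t • v b)) →
      P v)
    (hge : ∀ v, (∀ i, c ≤ inner ℝ u (v i)) → P v)
    (hle : ∀ v, (∀ i, inner ℝ u (v i) ≤ c) → P v) (v : Fin n → Euc n) : P v := by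
  induction hk : (Finset.univ.filter fun i => inner ℝ u (v i) ≠ c).card
    using Nat.strong_induction_on generalizing v with
  | _ k ih =>
    by_cases h1 : ∀ i, c ≤ inner ℝ u (v i)
    · exact hge v h1
    by_cases h2 : ∀ i, inner ℝ u (v i) ≤ c
    · exact hle v h2
    push Not at h1 h2
    obtain ⟨b, hb⟩ := h1
    obtain ⟨a, ha⟩ := h2
    have hab : a ≠ b := by
      rintro rfl
      exact lt_asymm ha hb
    have hd : 0 < inner ℝ u (v a) - inner ℝ u (v b) := by linarith
    set s := (c - inner ℝ u (v b)) / (inner ℝ u (v a) - inner ℝ u (v b)) with hs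
    set t := (inner ℝ u (v a) - c) / (inner ℝ u (v a) - inner ℝ u (v b)) with ht
    have hs0 : 0 < s := div_pos (by linarith) hd
    have ht0 : 0 < t := div_pos (by linarith) hd
    have hst : s + t = 1 := by
      rw [hs, ht, ← add_div, div_eq_one_iff_eq hd.ne']
      ring
    have hw : inner ℝ u (s • v a + t • v b) = c := by
      rw [inner_add_right, real_inner_smul_right, real_inner_smul_right, hs, ht]
      field_simp
      ring
    have key : ∀ j, inner ℝ u (v j) ≠ c →
        P (Function.update v j (s • v a + t • v b)) := by
      intro j hj
      refine ih _ ?_ _ rfl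
      rw [← hk]
      refine Finset.card_lt_card ⟨fun i hi => ?_, fun hsub => ?_⟩
      · simp only [Finset.mem_filter, Finset.mem_univ, true_and] at hi ⊢
        by_cases hij : i = j
        · exact hij ▸ hj
        · rwa [Function.update_of_ne hij] at hi
      · have := hsub (by simpa using hj : j ∈ Finset.univ.filter fun i => inner ℝ u (v i) ≠ c)
        simp [hw] at this
    exact hcut v a b s t hab hs0 ht0 hst (key b hb.ne) (key a ha.ne')

/-- The intersection of the half-spaces `⟨p, y⟩ ≤ c`, `(p, c) ∈ F`. -/
def polySet (F : Finset (Euc n × ℝ)) : Set (Euc n) := {y | ∀ p ∈ F, inner ℝ p.1 y ≤ p.2}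

theorem polySet_empty : polySet (∅ : Finset (Euc n × ℝ)) = Set.univ := by
  simp [polySet]

theorem polySet_insert [DecidableEq (Euc n × ℝ)] (p : Euc n × ℝ) (F : Finset (Euc n × ℝ)) :
    polySet (insert p F) = polySet F ∩ {y | inner ℝ p.1 y ≤ p.2} := by
  ext y
  simp [polySet, and_comm]

theorem convex_polySet (F : Finset (Euc n × ℝ)) : Convex ℝ (polySet F) := by
  classical
  induction F using Finset.induction_on with
  | empty => exact polySet_empty ▸ convex_univ
  | insert p F _ ih => exact polySet_insert p F ▸ ih.inter (convex_setOf_inner_le _ _)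

theorem isClosed_polySet (F : Finset (Euc n × ℝ)) : IsClosed (polySet F) := by
  classical
  induction F using Finset.induction_on with
  | empty => exact polySet_empty ▸ isClosed_univ
  | insert p F _ ih => exact polySet_insert p F ▸ ih.inter (isClosed_setOf_inner_le _ _)

/-- Outer approximation of a convex body by polyhedra. -/
theorem exists_polySet (K : ConvexBody (Euc n)) {B : Set (Euc n)} (hB : IsCompact B) {ε : ℝ}
    (hε : 0 < ε) : ∃ F : Finset (Euc n × ℝ), (K : Set (Euc n)) ⊆ polySet F ∧
      ∀ y ∈ B ∩ polySet F, infDist y (K : Set (Euc n)) < ε := by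
  classical
  choose z hz hsep using fun y => exists_supportFn_add_norm_sq_le K y
  have hB' : IsCompact (B ∩ {y | ε ≤ infDist y (K : Set (Euc n))}) :=
    hB.inter_right (isClosed_le continuous_const (continuous_infDist_pt _))
  obtain ⟨T, hT, hcover⟩ := hB'.elim_nhds_subcover
    (fun y => {q | supportFn K (y - z y) < inner ℝ (y - z y) q}) fun y hy => by
      refine (isOpen_lt continuous_const (by fun_prop)).mem_nhds ?_
      have h1 : ε ≤ ‖y - z y‖ := by
        rw [← dist_eq_norm]
        exact le_trans hy.2 (infDist_le_dist_of_mem (hz y))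
      have h2 : 0 < ‖y - z y‖ ^ 2 := by
        have : 0 < ‖y - z y‖ := hε.trans_le h1
        positivity
      rw [Set.mem_ofPred_eq]
      linarith [hsep y]
  refine ⟨T.image fun y => (y - z y, supportFn K (y - z y)), fun q hq p hp => ?_,
    fun q hq => ?_⟩
  · obtain ⟨y, -, rfl⟩ := Finset.mem_image.1 hp
    exact inner_le_supportFn K _ hq
  · by_contra! hcon
    obtain ⟨y, hy, hlt⟩ := Set.mem_iUnion₂.1 (hcover ⟨hq.1, hcon⟩)
    exact (hq.2 _ (Finset.mem_image_of_mem _ hy)).not_gt hlt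

namespace IsCovariantValuation

variable {R : ConvexBody (Euc n) → Euc n → ℝ} {I : Set ℝ}

theorem eq_zero_of_forall_polySet (h : IsCovariantValuation R) {K : ConvexBody (Euc n)}
    {B : Set (Euc n)} (hB : IsCompact B) (hB' : Convex ℝ B) (hK : (K : Set (Euc n)) ⊆ B)
    {x : Euc n} (hF : ∀ F, extend R (B ∩ polySet F) x = 0) : R K x = 0 := by
  by_contra hne
  have hpos : 0 < |R K x| := abs_pos.2 hne
  obtain ⟨δ, hδ, hball⟩ := Metric.mem_nhds_iff.1 ((Metric.tendsto_nhds.1 (h.tendsto K x)) _ hpos)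
  obtain ⟨F, hKF, hFK⟩ := exists_polySet K hB (half_pos hδ)
  let L : ConvexBody (Euc n) := ⟨B ∩ polySet F, hB'.inter (convex_polySet F),
    hB.inter_right (isClosed_polySet F), K.nonempty.mono (Set.subset_inter hK hKF)⟩
  have hLx : R L x = 0 := by
    rw [← extend_coe (R := R)]
    exact hF F
  have hd : dist L K ≤ δ / 2 := by
    refine hausdorffDist_le_of_mem_dist (half_pos hδ).le (fun y hy => ?_) fun y hy =>
      ⟨y, ⟨hK hy, hKF hy⟩, by rw [dist_self]; exact (half_pos hδ).le⟩
    obtain ⟨q, hq, hq'⟩ := K.isCompact.exists_infDist_eq_dist K.nonempty y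
    exact ⟨q, hq, hq' ▸ (hFK y hy).le⟩
  have hmem : dist (R L x) (R K x) < |R K x| :=
    hball (mem_ball.2 (hd.trans_lt (half_lt_self hδ)))
  rw [hLx, Real.dist_eq, zero_sub, abs_neg] at hmem
  exact lt_irrefl _ hmem

/-- Cutting off one more half-space. By `edge_induction` only simplices on one side of the bounding
hyperplane matter. -/
theorem extend_simplexSet_inter_eq_zero (h : IsCovariantValuation R) (hI : IsCompact I)
    (hI' : Convex ℝ I) {Q : Set (Euc n)} (hQ : IsClosed Q) (hQ' : Convex ℝ Q) {u : Euc n} {c : ℝ}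
    {x : Euc n} (h0 : ∀ v, extend R (simplexSet I v ∩ Q) x = 0)
    (hsec : ∀ v, extend R (simplexSet I v ∩ Q ∩ {y | inner ℝ u y = c}) x = 0)
    (hge : ∀ v, (∀ i, c ≤ inner ℝ u (v i)) →
      extend R (simplexSet I v ∩ Q ∩ {y | inner ℝ u y ≤ c}) x = 0)
    (hle : ∀ v, (∀ i, inner ℝ u (v i) ≤ c) →
      extend R (simplexSet I v ∩ Q ∩ {y | c ≤ inner ℝ u y}) x = 0) (v : Fin n → Euc n) :
    extend R (simplexSet I v ∩ (Q ∩ {y | inner ℝ u y ≤ c})) x = 0 := by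
  refine edge_induction u c (P := fun v =>
    extend R (simplexSet I v ∩ (Q ∩ {y | inner ℝ u y ≤ c})) x = 0) ?_ ?_ ?_ v
  · intro v a b s t hab hs ht hst h1 h2
    rw [h.extend_simplexSet_cut hI hI' (hQ.inter (isClosed_setOf_inner_le u c))
      (hQ'.inter (convex_setOf_inner_le u c)) v hab hs ht hst, h1, h2, add_zero]
  · intro v hv
    rw [← Set.inter_assoc]
    exact hge v hv
  · intro v hv
    have h1 := h.extend_cut ((convex_simplexSet hI' v).inter hQ')
      ((isCompact_simplexSet hI v).inter_right hQ) u c x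
    rw [hle v hv, h0, hsec, add_zero, add_zero] at h1
    rw [← Set.inter_assoc]
    exact h1

/-- The case of half-spaces bounded by hyperplanes through the origin. -/
theorem extend_simplexSet_inter_polySet_linear (h : IsCovariantValuation R) (hI : IsCompact I)
    (hI' : Convex ℝ I) {x : Euc n} (h0 : ∀ v, extend R (simplexSet I v) x = 0)
    (F : Finset (Euc n × ℝ)) (hF : ∀ p ∈ F, p.2 = 0) (v : Fin n → Euc n) :
    extend R (simplexSet I v ∩ polySet F) x = 0 := by
  classical
  induction F using Finset.induction_on generalizing v with
  | empty => rw [polySet_empty, Set.inter_univ, h0]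
  | insert p F _ ih =>
    have ih' := ih fun q hq => hF q (Finset.mem_insert_of_mem hq)
    have hp : p.2 = 0 := hF p (Finset.mem_insert_self _ _)
    rw [polySet_insert, hp]
    rcases eq_or_ne p.1 0 with hp0 | hp0
    · simp only [hp0, inner_zero_left, le_refl, Set.ofPred_true, Set.inter_univ]
      exact ih' v
    have hplane : ∀ A : Set (Euc n), (∀ y ∈ A, inner ℝ p.1 y = 0) → extend R A x = 0 :=
      fun A hA => h.extend_eq_zero_of_inner_eq_zero hp0 hA x
    refine h.extend_simplexSet_inter_eq_zero hI hI' (isClosed_polySet F) (convex_polySet F) ih'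
      (fun v => hplane _ fun y hy => hy.2) ?_ ?_ v
    · intro v hv
      refine hplane _ fun y hy => le_antisymm hy.2 ?_
      obtain ⟨c, hc, -, rfl⟩ := hy.1.1
      rw [inner_sum_smul]
      exact Finset.sum_nonneg fun i _ => mul_nonneg (hc i) (hv i)
    · intro v hv
      refine hplane _ fun y hy => le_antisymm ?_ hy.2
      obtain ⟨c, hc, -, rfl⟩ := hy.1.1
      rw [inner_sum_smul]
      exact Finset.sum_nonpos fun i _ => mul_nonpos_of_nonneg_of_nonpos (hc i) (hv i)

end IsCovariantValuation

/-- A hyperplane that has the vertices `vᵢ` on one side and the origin on the other cuts off a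
simplex with vertex at the origin. -/
theorem simplexSet_inter_le_eq {v : Fin n → Euc n} {u : Euc n} {c : ℝ} (hc : 0 < c)
    (hv : ∀ i, c ≤ inner ℝ u (v i)) :
    simplexSet (Set.Icc 0 1) v ∩ {y | inner ℝ u y ≤ c} =
      simplexSet (Set.Icc 0 1) fun i => (c / inner ℝ u (v i)) • v i := by
  have hpos : ∀ i, 0 < inner ℝ u (v i) := fun i => hc.trans_le (hv i)
  ext y
  constructor
  · rintro ⟨⟨d, hd, -, rfl⟩, hy⟩
    rw [Set.mem_ofPred_eq, inner_sum_smul] at hy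
    have h0 : ∀ i, 0 ≤ d i * inner ℝ u (v i) / c := fun i =>
      div_nonneg (mul_nonneg (hd i) (hpos i).le) hc.le
    refine ⟨fun i => d i * inner ℝ u (v i) / c, h0,
      ⟨Finset.sum_nonneg fun i _ => h0 i, ?_⟩, ?_⟩
    · rwa [← Finset.sum_div, div_le_one hc]
    · refine Finset.sum_congr rfl fun i _ => ?_
      rw [smul_smul]
      congr 1
      have := (hpos i).ne'
      field_simp
  · rintro ⟨d, hd, hd1, rfl⟩
    have h0 : ∀ i, 0 ≤ d i * (c / inner ℝ u (v i)) := fun i =>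
      mul_nonneg (hd i) (div_nonneg hc.le (hpos i).le)
    refine ⟨⟨fun i => d i * (c / inner ℝ u (v i)), h0,
      ⟨Finset.sum_nonneg fun i _ => h0 i, ?_⟩, ?_⟩, ?_⟩
    · refine le_trans (Finset.sum_le_sum fun i _ => ?_) hd1.2
      exact mul_le_of_le_one_right (hd i) ((div_le_one (hpos i)).2 (hv i))
    · exact Finset.sum_congr rfl fun i _ => smul_smul _ _ _
    · rw [Set.mem_ofPred_eq, inner_sum_smul]
      have h1 : ∀ i, d i * inner ℝ u ((c / inner ℝ u (v i)) • v i) = d i * c := fun i => by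
        rw [real_inner_smul_right, div_mul_cancel₀ _ (hpos i).ne']
      simp only [h1]
      rw [← Finset.sum_mul]
      exact mul_le_of_le_one_left hc.le hd1.2

/-- The case of arbitrary half-spaces, for a functional that vanishes on all bodies in
hyperplanes. -/
theorem IsCovariantValuation.extend_simplexSet_inter_polySet
    {R : ConvexBody (Euc n) → Euc n → ℝ} (h : IsCovariantValuation R) {x : Euc n}
    (h0 : ∀ v, extend R (simplexSet (Set.Icc 0 1) v) x = 0)
    (hplane : ∀ (u : Euc n) (c : ℝ) (A : Set (Euc n)), u ≠ 0 → (∀ y ∈ A, inner ℝ u y = c) →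
      extend R A x = 0) (F : Finset (Euc n × ℝ)) (v : Fin n → Euc n) :
    extend R (simplexSet (Set.Icc 0 1) v ∩ polySet F) x = 0 := by
  classical
  induction F using Finset.induction_on generalizing v with
  | empty => rw [polySet_empty, Set.inter_univ, h0]
  | insert p F _ ih =>
    rw [polySet_insert]
    rcases eq_or_ne p.1 0 with hp0 | hp0
    · rcases le_or_gt 0 p.2 with h2 | h2
      · simp only [hp0, inner_zero_left, h2, Set.ofPred_true, Set.inter_univ]
        exact ih v
      · simp only [hp0, inner_zero_left, h2.not_ge, Set.ofPred_false, Set.inter_empty,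
          extend_empty]
    have key : ∀ (u : Euc n) (c : ℝ), u ≠ 0 → ∀ v : Fin n → Euc n, (∀ i, c ≤ inner ℝ u (v i)) →
        extend R (simplexSet (Set.Icc 0 1) v ∩ polySet F ∩ {y | inner ℝ u y ≤ c}) x = 0 := by
      intro u c hu v hv
      rcases lt_or_ge 0 c with hc | hc
      · rw [Set.inter_right_comm, simplexSet_inter_le_eq hc hv, ih]
      · refine hplane u c _ hu fun y hy => le_antisymm hy.2 ?_
        obtain ⟨d, hd, hd1, rfl⟩ := hy.1.1
        rw [inner_sum_smul]
        calc c ≤ (∑ i, d i) * c := by nlinarith [hd1.2]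
          _ = ∑ i, d i * c := Finset.sum_mul _ _ _
          _ ≤ ∑ i, d i * inner ℝ u (v i) :=
            Finset.sum_le_sum fun i _ => mul_le_mul_of_nonneg_left (hv i) (hd i)
    refine h.extend_simplexSet_inter_eq_zero isCompact_Icc (convex_Icc 0 1) (isClosed_polySet F)
      (convex_polySet F) ih (fun v => hplane p.1 p.2 _ hp0 fun y hy => hy.2)
      (key p.1 p.2 hp0) ?_ v
    intro v hv
    have h1 := key (-p.1) (-p.2) (neg_ne_zero.2 hp0) v fun i => by
      rw [inner_neg_left]
      exact neg_le_neg (hv i)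
    simpa only [inner_neg_left, neg_le_neg_iff] using h1

/-! ### Uniqueness -/

theorem inner_stdVec (u : Euc n) (i : Fin n) : inner ℝ u (stdVec i) = u i := by
  rw [real_inner_comm]
  simp [stdVec, EuclideanSpace.inner_single_left]

theorem eq_sum_stdVec (y : Euc n) : y = ∑ i, y i • stdVec i := by
  ext j
  simp [stdVec, Pi.single_apply]

theorem inner_eq_of_mem_simplexSet {v : Fin n → Euc n} {u : Euc n} {c : ℝ}
    (hv : ∀ i, inner ℝ u (v i) = c) {y : Euc n} (hy : y ∈ simplexSet {1} v) :
    inner ℝ u y = c := by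
  obtain ⟨d, -, hd, rfl⟩ := hy
  rw [inner_sum_smul]
  simp only [hv]
  rw [← Finset.sum_mul, Set.mem_singleton_iff.1 hd, one_mul]

/-- A body in the hyperplane `⟨u, y⟩ = 1` is contained in a simplex of that hyperplane: blow up a
fixed simplex from its barycentre. -/
theorem exists_subset_simplexSet {u : Euc n} (hu : u ≠ 0) {K : ConvexBody (Euc n)}
    (hK : ∀ y ∈ (K : Set (Euc n)), inner ℝ u y = 1) :
    ∃ v : Fin n → Euc n, (∀ i, inner ℝ u (v i) = 1) ∧ (K : Set (Euc n)) ⊆ simplexSet {1} v := by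
  obtain ⟨k, hk⟩ : ∃ k, u k ≠ 0 := by
    by_contra! hcon
    exact hu (by ext i; exact hcon i)
  have hn : (0 : ℝ) < n := by exact_mod_cast k.pos
  -- points `wᵢ` of the hyperplane, and affine coordinates `d` with respect to them
  let w : Fin n → Euc n := fun i => stdVec i + ((1 - u i) / u k) • stdVec k
  have hw : ∀ i, inner ℝ u (w i) = 1 := fun i => by
    simp only [w, inner_add_right, real_inner_smul_right, inner_stdVec]
    rw [div_mul_cancel₀ _ hk]
    ring
  let d : Euc n → Fin n → ℝ := fun y i => y i + if i = k then 1 - ∑ j, y j else 0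
  have hd1 : ∀ y, ∑ i, d y i = 1 := fun y => by
    simp [d, Finset.sum_add_distrib]
  have hdy : ∀ y, inner ℝ u y = 1 → ∑ i, d y i • w i = y := by
    intro y hy
    have huy : ∑ i, d y i * u i = 1 + (1 - ∑ j, y j) * u k := by
      have h1 : ∑ i, y i * u i = 1 := by
        rw [← hy]
        simp [PiLp.inner_apply, mul_comm]
      simp [d, add_mul, Finset.sum_add_distrib, h1]
    have h2 : ∑ i, d y i * ((1 - u i) / u k) = -(1 - ∑ j, y j) := by
      have h3 : ∀ i, d y i * ((1 - u i) / u k) = (d y i - d y i * u i) / u k := fun i => by ring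
      simp only [h3]
      rw [← Finset.sum_div, Finset.sum_sub_distrib, hd1, huy]
      field_simp
      ring
    have h4 : ∑ i, d y i • w i =
        (∑ i, d y i • stdVec i) + (∑ i, d y i * ((1 - u i) / u k)) • (stdVec k : Euc n) := by
      simp only [w, smul_add, Finset.sum_add_distrib, smul_smul, Finset.sum_smul]
    have h5 : ∑ i, d y i • (stdVec i : Euc n) = y + (1 - ∑ j, y j) • stdVec k := by
      simp only [d, add_smul, Finset.sum_add_distrib, ite_smul, zero_smul, Finset.sum_ite_eq',
        Finset.mem_univ, if_true]
      rw [← eq_sum_stdVec y]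
    rw [h4, h5, h2]
    module
  obtain ⟨C, hC⟩ : ∃ C : ℝ, ∀ y ∈ (K : Set (Euc n)), ∀ i, -C ≤ d y i := by
    have hbd : ∀ i, ∃ C : ℝ, ∀ y ∈ (K : Set (Euc n)), -C ≤ d y i := fun i => by
      have hc : Continuous fun y : Euc n => d y i := by
        by_cases hik : i = k
        · simp only [d, hik, if_true]
          fun_prop
        · simp only [d, hik, if_false]
          fun_prop
      obtain ⟨C, hC⟩ := (K.isCompact.image hc).bddBelow
      exact ⟨-C, fun y hy => by rw [neg_neg]; exact hC ⟨y, hy, rfl⟩⟩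
    choose C hC using hbd
    exact ⟨∑ i, |C i|, fun y hy i => (neg_le_neg ((le_abs_self (C i)).trans
      (Finset.single_le_sum (fun j _ => abs_nonneg (C j)) (Finset.mem_univ i)))).trans
      (hC i y hy)⟩
  -- blown up by `r`, the simplex gives barycentric coordinates `1/n + (dᵢ - 1/n) / r ≥ 0`
  set r : ℝ := n * (|C| + 1) with hr
  have hr0 : 0 < r := by positivity
  set p : Euc n := (n : ℝ)⁻¹ • ∑ i, w i with hp
  have hsn : ∑ _i : Fin n, (n : ℝ)⁻¹ = 1 := by
    rw [Finset.sum_const, Finset.card_univ, Fintype.card_fin, nsmul_eq_mul,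
      mul_inv_cancel₀ hn.ne']
  have hup : inner ℝ u p = 1 := by
    rw [hp, real_inner_smul_right, inner_sum]
    simp only [hw]
    rw [Finset.mul_sum]
    simpa using hsn
  refine ⟨fun i => p + r • (w i - p), fun i => ?_, fun y hy => ?_⟩
  · rw [inner_add_right, hup, real_inner_smul_right, inner_sub_right, hup, hw, sub_self, mul_zero,
      add_zero]
  · have hsum : ∑ i, ((n : ℝ)⁻¹ + (d y i - (n : ℝ)⁻¹) / r) = 1 := by
      rw [Finset.sum_add_distrib, ← Finset.sum_div, Finset.sum_sub_distrib, hd1, hsn]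
      simp
    refine ⟨fun i => (n : ℝ)⁻¹ + (d y i - (n : ℝ)⁻¹) / r, fun i => ?_, hsum, ?_⟩
    · have h1 : -(|C| + 1) ≤ d y i - (n : ℝ)⁻¹ := by
        have h2 : (n : ℝ)⁻¹ ≤ 1 := inv_le_one_of_one_le₀ (by exact_mod_cast k.pos)
        linarith [hC y hy i, le_abs_self C]
      have h3 : -(n : ℝ)⁻¹ ≤ (d y i - (n : ℝ)⁻¹) / r := by
        rw [le_div_iff₀ hr0, hr, neg_mul, inv_mul_cancel_left₀ hn.ne']
        exact h1
      linarith
    · have h1 : ∀ i, ((n : ℝ)⁻¹ + (d y i - (n : ℝ)⁻¹) / r) • (p + r • (w i - p)) =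
          ((n : ℝ)⁻¹ + (d y i - (n : ℝ)⁻¹) / r) • ((1 - r) • p) +
            ((r - 1) • (n : ℝ)⁻¹ • w i + d y i • w i) := by
        intro i
        have h2 : r * ((n : ℝ)⁻¹ + (d y i - (n : ℝ)⁻¹) / r) = (r - 1) * (n : ℝ)⁻¹ + d y i := by
          field_simp
          ring
        rw [smul_smul (r - 1), ← add_smul ((r - 1) * (n : ℝ)⁻¹), ← h2]
        module
      simp only [h1]
      rw [Finset.sum_add_distrib, Finset.sum_add_distrib, ← Finset.sum_smul, hsum,
        ← Finset.smul_sum, ← Finset.smul_sum, ← hp, hdy y (hK y hy)]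
      module

/-- The polyhedra in the hyperplane `⟨u, y⟩ = 1` are cut out by hyperplanes through the origin. -/
theorem inter_polySet_eq_linear {B : Set (Euc n)} {u : Euc n} (hB : ∀ y ∈ B, inner ℝ u y = 1)
    (F : Finset (Euc n × ℝ)) : ∃ F' : Finset (Euc n × ℝ), (∀ p ∈ F', p.2 = 0) ∧
      B ∩ polySet F = B ∩ polySet F' := by
  classical
  refine ⟨F.image fun p => (p.1 - p.2 • u, 0), fun p hp => ?_, ?_⟩
  · obtain ⟨q, -, rfl⟩ := Finset.mem_image.1 hp
    rfl
  · ext y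
    refine and_congr_right fun hy => ?_
    simp only [polySet, Set.mem_ofPred_eq, Finset.forall_mem_image]
    refine forall₂_congr fun p _ => ?_
    rw [inner_sub_left, real_inner_smul_left, hB y hy, mul_one, sub_nonpos]

namespace IsCovariantValuation

variable {R : ConvexBody (Euc n) → Euc n → ℝ}

theorem eq_zero_of_inner_eq (h : IsCovariantValuation R) {x : Euc n}
    (h0 : ∀ v, extend R (simplexSet {1} v) x = 0) {u : Euc n} (hu : u ≠ 0) {c : ℝ}
    {K : ConvexBody (Euc n)} (hK : ∀ y ∈ (K : Set (Euc n)), inner ℝ u y = c) : R K x = 0 := by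
  rcases eq_or_ne c 0 with rfl | hc
  · exact h.eq_zero_of_inner_eq_zero hu hK x
  have hK' : ∀ y ∈ (K : Set (Euc n)), inner ℝ (c⁻¹ • u) y = 1 := fun y hy => by
    rw [real_inner_smul_left, hK y hy, inv_mul_cancel₀ hc]
  obtain ⟨v, hv, hKv⟩ := exists_subset_simplexSet (smul_ne_zero (inv_ne_zero hc) hu) hK'
  refine h.eq_zero_of_forall_polySet (isCompact_simplexSet isCompact_singleton v)
    (convex_simplexSet (convex_singleton 1) v) hKv fun F => ?_
  obtain ⟨F', hF', hFF'⟩ := inter_polySet_eq_linear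
    (fun y hy => inner_eq_of_mem_simplexSet hv hy) F
  rw [hFF']
  exact h.extend_simplexSet_inter_polySet_linear isCompact_singleton (convex_singleton 1) h0 F'
    hF' v

/-- Cutting by the coordinate hyperplanes. -/
theorem extend_eq_zero_of_orthants (h : IsCovariantValuation R) {x : Euc n} (J : Finset (Fin n))
    {A : Set (Euc n)} (hA : Convex ℝ A) (hA' : IsCompact A)
    (hJ : ∀ σ : Fin n → ℝ, (∀ i, σ i = 1 ∨ σ i = -1) →
      extend R (A ∩ {y | ∀ i ∈ J, 0 ≤ σ i * y i}) x = 0) : extend R A x = 0 := by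
  induction J using Finset.induction_on generalizing A with
  | empty => simpa using hJ (fun _ => 1) fun _ => Or.inl rfl
  | insert j J hj ih =>
    have hne : (stdVec j : Euc n) ≠ 0 := fun h0 => by
      have := congrArg (fun y : Euc n => y j) h0
      simp [stdVec] at this
    have hin : ∀ y : Euc n, inner ℝ (stdVec j) y = y j := fun y => by
      rw [real_inner_comm, inner_stdVec]
    have hset : ∀ (σ : Fin n → ℝ) (e : ℝ), A ∩ {y : Euc n | 0 ≤ e * y j} ∩
        {y | ∀ i ∈ J, 0 ≤ σ i * y i} =
        A ∩ {y | ∀ i ∈ insert j J, 0 ≤ Function.update σ j e i * y i} := by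
      intro σ e
      rw [Set.inter_assoc]
      congr 1
      ext y
      simp only [Set.mem_inter_iff, Set.mem_ofPred_eq, Finset.forall_mem_insert,
        Function.update_self]
      refine and_congr_right fun _ => forall₂_congr fun i hi => ?_
      rw [Function.update_of_ne (fun h : i = j => hj (h ▸ hi))]
    have hside : ∀ e : ℝ, e = 1 ∨ e = -1 → ∀ σ : Fin n → ℝ, (∀ i, σ i = 1 ∨ σ i = -1) →
        extend R (A ∩ {y : Euc n | 0 ≤ e * y j} ∩ {y | ∀ i ∈ J, 0 ≤ σ i * y i}) x = 0 := by
      intro e he σ hσ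
      rw [hset]
      refine hJ _ fun i => ?_
      by_cases hij : i = j
      · rw [hij, Function.update_self]
        exact he
      · rw [Function.update_of_ne hij]
        exact hσ i
    have h1 : {y : Euc n | inner ℝ (stdVec j) y ≤ 0} = {y | 0 ≤ (-1) * y j} := by
      ext y
      simp [hin]
    have h2 : {y : Euc n | 0 ≤ inner ℝ (stdVec j) y} = {y | 0 ≤ (1 : ℝ) * y j} := by
      ext y
      simp [hin]
    rw [h.extend_cut_zero hA hA' hne, h1, h2]
    rw [ih (h1 ▸ hA.inter (convex_setOf_inner_le _ _))
        (h1 ▸ hA'.inter_right (isClosed_setOf_inner_le _ _)) (hside (-1) (Or.inr rfl)),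
      ih (h2 ▸ hA.inter (convex_setOf_le_inner _ _))
        (h2 ▸ hA'.inter_right (isClosed_setOf_le_inner _ _)) (hside 1 (Or.inl rfl)), add_zero]

/-- A covariant valuation is determined by its values at the standard simplex `T` with vertex at
the origin and at the facet of `T` opposite to the origin, in the two directions
`±(1, …, 1)`. -/
theorem eq_zero (h : IsCovariantValuation R) (hn : 2 ≤ n)
    (hT1 : extend R (simplexSet (Set.Icc 0 1) stdVec) (constVec 1) = 0)
    (hT2 : extend R (simplexSet (Set.Icc 0 1) stdVec) (constVec (-1)) = 0)
    (hS1 : extend R (simplexSet {1} stdVec) (constVec 1) = 0)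
    (hS2 : extend R (simplexSet {1} stdVec) (constVec (-1)) = 0)
    (K : ConvexBody (Euc n)) (x : Euc n) : R K x = 0 := by
  have hS : ∀ v, extend R (simplexSet {1} v) x = 0 := fun v =>
    h.extend_simplexSet_eq_zero hn isCompact_singleton (convex_singleton 1) hS1 hS2 v x
  have hT : ∀ v, extend R (simplexSet (Set.Icc 0 1) v) x = 0 := fun v =>
    h.extend_simplexSet_eq_zero hn isCompact_Icc (convex_Icc 0 1) hT1 hT2 v x
  have hplane : ∀ (u : Euc n) (c : ℝ) (A : Set (Euc n)), u ≠ 0 →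
      (∀ y ∈ A, inner ℝ u y = c) → extend R A x = 0 := fun u c A hu hA =>
    extend_eq_zero fun _ hL => h.eq_zero_of_inner_eq hS hu fun y hy => hA y (hL ▸ hy)
  rw [← extend_coe (R := R)]
  refine h.extend_eq_zero_of_orthants Finset.univ K.convex K.isCompact fun σ hσ => ?_
  refine extend_eq_zero fun L hL => ?_
  obtain ⟨C, hC⟩ := K.isBounded.exists_norm_le
  -- `∑ |yᵢ| ≤ r` on `K`, so `r T`, reflected, contains the part of `K` in an orthant
  set r : ℝ := n * (|C| + 1) with hr
  have hn0 : (0 : ℝ) < n := by exact_mod_cast (by omega : 0 < n)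
  have hr0 : 0 < r := by positivity
  have hσσ : ∀ i, σ i * σ i = 1 := fun i => by rcases hσ i with h1 | h1 <;> rw [h1] <;> norm_num
  refine h.eq_zero_of_forall_polySet (B := simplexSet (Set.Icc 0 1) fun i => (r * σ i) • stdVec i)
    (isCompact_simplexSet isCompact_Icc _) (convex_simplexSet (convex_Icc 0 1) _) ?_
    fun F => h.extend_simplexSet_inter_polySet hT hplane F _
  intro y hy
  rw [hL] at hy
  have h0 : ∀ i, 0 ≤ σ i * y i / r := fun i => div_nonneg (hy.2 i (Finset.mem_univ i)) hr0.le
  refine ⟨fun i => σ i * y i / r, h0, ⟨Finset.sum_nonneg fun i _ => h0 i, ?_⟩, ?_⟩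
  · rw [← Finset.sum_div, div_le_one hr0]
    calc ∑ i, σ i * y i ≤ ∑ _i : Fin n, (|C| + 1) := by
          refine Finset.sum_le_sum fun i _ => ?_
          have h1 : |σ i| = 1 := by rcases hσ i with h1 | h1 <;> rw [h1] <;> simp
          calc σ i * y i ≤ |σ i * y i| := le_abs_self _
            _ = ‖y i‖ := by rw [abs_mul, h1, one_mul, Real.norm_eq_abs]
            _ ≤ ‖y‖ := PiLp.norm_apply_le y i
            _ ≤ |C| + 1 := by linarith [hC y hy.1, le_abs_self C]
      _ = r := by simp [hr, mul_add]
  · conv_lhs => rw [eq_sum_stdVec y]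
    refine Finset.sum_congr rfl fun i _ => ?_
    rw [smul_smul]
    congr 1
    rw [div_mul_eq_mul_div, eq_div_iff hr0.ne']
    linear_combination (-(y i * r)) * hσσ i

end IsCovariantValuation

/-! ### The standard simplices -/

/-- The standard simplex with vertices `0, e₁, …, eₙ`. -/
def stdSimplexBody (n : ℕ) : ConvexBody (Euc n) where
  carrier := simplexSet (Set.Icc 0 1) stdVec
  convex' := convex_simplexSet (convex_Icc 0 1) _
  isCompact' := isCompact_simplexSet isCompact_Icc _
  nonempty' := ⟨0, 0, fun _ => le_rfl, by simp, by simp⟩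

/-- The facet with vertices `e₁, …, eₙ` of the standard simplex. -/
def stdFacetBody (hn : 0 < n) : ConvexBody (Euc n) where
  carrier := simplexSet {1} stdVec
  convex' := convex_simplexSet (convex_singleton 1) _
  isCompact' := isCompact_simplexSet isCompact_singleton _
  nonempty' := ⟨_, Pi.single ⟨0, hn⟩ 1, fun i => by
    by_cases hi : i = ⟨0, hn⟩ <;> simp [hi], by simp, rfl⟩

theorem hullBody_stdFacetBody (hn : 0 < n) : hullBody (stdFacetBody hn) = stdSimplexBody n := by
  refine ConvexBody.ext (Set.ext fun y => ?_)
  refine mem_hullZero.trans ?_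
  constructor
  · rintro ⟨t, ht, _, ⟨c, hc, hc1, rfl⟩, rfl⟩
    have hs : ∑ i, t * c i = t := by rw [← Finset.mul_sum, Set.mem_singleton_iff.1 hc1, mul_one]
    refine ⟨fun i => t * c i, fun i => mul_nonneg ht.1 (hc i), ?_, ?_⟩
    · rw [hs]
      exact ht
    · simp only [Finset.smul_sum, smul_smul]
  · rintro ⟨c, hc, hc1, rfl⟩
    rcases eq_or_lt_of_le hc1.1 with h0 | hpos
    · obtain ⟨z, hz⟩ := (stdFacetBody hn).nonempty
      have hc0 : ∀ i, c i = 0 := fun i =>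
        (Finset.sum_eq_zero_iff_of_nonneg fun j _ => hc j).1 h0.symm i (Finset.mem_univ i)
      exact ⟨0, ⟨le_rfl, zero_le_one⟩, z, hz, by simp [hc0]⟩
    · refine ⟨∑ i, c i, hc1, ∑ i, (c i / ∑ j, c j) • stdVec i,
        ⟨fun i => c i / ∑ j, c j, fun i => div_nonneg (hc i) hpos.le, ?_, rfl⟩, ?_⟩
      · rw [Set.mem_singleton_iff, ← Finset.sum_div, div_self hpos.ne']
      · rw [Finset.smul_sum]
        refine Finset.sum_congr rfl fun i _ => ?_
        rw [smul_smul, mul_div_cancel₀ _ hpos.ne']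

theorem hullBody_stdSimplexBody : hullBody (stdSimplexBody n) = stdSimplexBody n := by
  refine ConvexBody.ext ?_
  change convexHull ℝ (insert 0 (stdSimplexBody n : Set (Euc n))) = _
  have h0 : (0 : Euc n) ∈ (stdSimplexBody n : Set (Euc n)) :=
    ⟨0, fun _ => le_rfl, by simp, by simp⟩
  rw [Set.insert_eq_of_mem h0, (stdSimplexBody n).convex.convexHull_eq]

theorem inner_constVec_stdVec (r : ℝ) (i : Fin n) : inner ℝ (constVec r) (stdVec i) = r := by
  rw [inner_stdVec]
  rfl

theorem inner_constVec_neg (y : Euc n) :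
    inner ℝ (constVec (-1)) y = -inner ℝ (constVec 1) y := by
  have h : (constVec (-1) : Euc n) = -constVec 1 := by
    ext i
    simp [constVec]
  rw [h, inner_neg_left]

theorem volume_stdFacetBody (hn : 0 < n) : volume (stdFacetBody hn : Set (Euc n)) = 0 := by
  let s : AffineSubspace ℝ (Euc n) :=
    AffineSubspace.mk' (stdVec ⟨0, hn⟩) (LinearMap.ker (innerₗ (Euc n) (constVec 1)))
  have hs : ∀ y, y ∈ s ↔ inner ℝ (constVec 1) y = 1 := fun y => by
    rw [AffineSubspace.mem_mk', LinearMap.mem_ker, innerₗ_apply_apply, vsub_eq_sub,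
      inner_sub_right, inner_constVec_stdVec, sub_eq_zero]
  have hne : s ≠ ⊤ := fun htop => by
    have := (hs 0).1 (htop ▸ AffineSubspace.mem_top ℝ (Euc n) 0)
    simp at this
  refine measure_mono_null (fun y hy => ?_) (Measure.addHaar_affineSubspace volume s hne)
  exact (hs y).2 (inner_eq_of_mem_simplexSet (inner_constVec_stdVec 1) hy)

theorem momentFn_stdFacetBody (hn : 0 < n) (g : ℝ → ℝ) (x : Euc n) :
    momentFn g (stdFacetBody hn) x = 0 :=
  setIntegral_measure_zero _ (volume_stdFacetBody hn)

theorem inner_constVec_nonneg {y : Euc n} (hy : y ∈ (stdSimplexBody n : Set (Euc n))) :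
    0 ≤ inner ℝ (constVec 1) y := by
  obtain ⟨c, hc, -, rfl⟩ := hy
  rw [inner_sum_smul]
  exact Finset.sum_nonneg fun i _ => by
    rw [inner_constVec_stdVec, mul_one]
    exact hc i

theorem momentFn_id_stdSimplexBody_pos (hn : 0 < n) :
    0 < momentFn (fun t => t) (stdSimplexBody n) (constVec 1) := by
  rw [momentFn, setIntegral_pos_iff_support_of_nonneg_ae
    ((ae_restrict_iff' (measurableSet_coe _)).2
      (Eventually.of_forall fun y hy => inner_constVec_nonneg hy))
    (integrableOn_of_continuous (f := fun y : Euc n => inner ℝ (constVec 1) y) (by fun_prop) _)]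
  have hin : ∀ y : Euc n, inner ℝ (constVec 1) y = ∑ i, y i := fun y => by
    simp [constVec, PiLp.inner_apply]
  let U : Set (Euc n) := {y | (∀ i, 0 < y i) ∧ ∑ i, y i < 1}
  have hU : IsOpen U := by
    have hUeq : U = (⋂ i : Fin n, {y : Euc n | 0 < y i}) ∩ {y | ∑ i, y i < 1} := by
      ext y
      simp [U]
    rw [hUeq]
    exact (isOpen_iInter_of_finite fun i => isOpen_lt continuous_const (by fun_prop)).inter
      (isOpen_lt (by fun_prop) continuous_const)
  have hU0 : U.Nonempty := by
    have hn1 : (0 : ℝ) < n + 1 := by positivity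
    refine ⟨constVec ((n + 1 : ℝ)⁻¹), fun i => inv_pos.2 hn1, ?_⟩
    have h1 : ∑ i, (constVec ((n + 1 : ℝ)⁻¹) : Euc n) i = n * (n + 1 : ℝ)⁻¹ := by
      simp [constVec]
    rw [h1, ← div_eq_mul_inv, div_lt_one hn1]
    linarith
  refine (hU.measure_pos volume hU0).trans_le (measure_mono fun y hy => ⟨?_, ?_⟩)
  · rw [Function.mem_support, hin]
    exact (Finset.sum_pos (fun i _ => hy.1 i) ⟨⟨0, hn⟩, Finset.mem_univ _⟩).ne'
  · exact ⟨y, fun i => (hy.1 i).le, ⟨Finset.sum_nonneg fun i _ => (hy.1 i).le, hy.2.le⟩,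
      eq_sum_stdVec y⟩

theorem momentFn_id_constVec_neg (K : ConvexBody (Euc n)) :
    momentFn (fun t => t) K (constVec (-1)) = -momentFn (fun t => t) K (constVec 1) := by
  simp only [momentFn, inner_constVec_neg]
  exact integral_neg _

theorem momentFn_abs_constVec_neg (K : ConvexBody (Euc n)) :
    momentFn (fun t => |t|) K (constVec (-1)) = momentFn (fun t => |t|) K (constVec 1) := by
  simp only [momentFn, inner_constVec_neg, abs_neg]

theorem momentFn_abs_stdSimplexBody :
    momentFn (fun t => |t|) (stdSimplexBody n) (constVec 1) =
      momentFn (fun t => t) (stdSimplexBody n) (constVec 1) :=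
  setIntegral_congr_fun (measurableSet_coe _) fun _ hy => abs_of_nonneg (inner_constVec_nonneg hy)

/-! ### The classification -/

theorem isCovariantValuation_combination (a₁ a₂ a₃ a₄ : ℝ) :
    IsCovariantValuation (n := n) fun K x => a₁ * momentFn (fun t => t) K x +
        a₂ * (momentFn (fun t => t) (hullBody K) x - momentFn (fun t => t) K x) +
        a₃ * momentFn (fun t => |t|) K x +
        a₄ * (momentFn (fun t => |t|) (hullBody K) x - momentFn (fun t => |t|) K x) :=
  (((isCovariantValuation_momentFn_id.const_mul a₁).add
    ((isCovariantValuation_momentFn_id.comp_hullBody.sub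
      isCovariantValuation_momentFn_id).const_mul a₂)).add
    (isCovariantValuation_momentFn_abs.const_mul a₃)).add
    ((isCovariantValuation_momentFn_abs.comp_hullBody.sub
      isCovariantValuation_momentFn_abs).const_mul a₄)

/-- The coefficient of the even part is nonnegative because `h(K, x) + h(K, -x) ≥ 0`. -/
theorem exists_coefficients (K : ConvexBody (Euc n)) {m : ℝ} (hm : 0 < m) :
    ∃ a b : ℝ, 0 ≤ b ∧ supportFn K (constVec 1) = a * m + b * m ∧
      supportFn K (constVec (-1)) = a * (-m) + b * m := by
  have hneg : (constVec (-1) : Euc n) = -constVec 1 := by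
    ext i
    simp [constVec]
  refine ⟨(supportFn K (constVec 1) - supportFn K (constVec (-1))) / (2 * m),
    (supportFn K (constVec 1) + supportFn K (constVec (-1))) / (2 * m),
    div_nonneg ?_ (by positivity), ?_, ?_⟩
  · have := neg_supportFn_neg_le K (constVec 1)
    rw [hneg]
    linarith
  · field_simp
    ring
  · field_simp
    ring

end MinkowskiVal
end

open MinkowskiVal in
theorem mainTheorem2 (n : ℕ) (hn : 3 ≤ n)
    (Φ : ConvexBody (MinkowskiVal.Euc n) → ConvexBody (MinkowskiVal.Euc n)) :
    (MinkowskiVal.IsMinkowskiValuation Φ ∧ Continuous Φ ∧ MinkowskiVal.IsSLEquivariant Φ ∧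
        MinkowskiVal.IsHomogeneousOfDegree ((n : ℝ) + 1) Φ) ↔
      ∃ a₁ a₂ a₃ a₄ : ℝ, 0 ≤ a₃ ∧ 0 ≤ a₄ ∧
        ∀ K : ConvexBody (MinkowskiVal.Euc n),
          Φ K = a₁ • MinkowskiVal.momentVector K + a₂ • MinkowskiVal.momentVectorStar K +
            a₃ • MinkowskiVal.momentBody K + a₄ • MinkowskiVal.momentBodyStar K := by
  have hn0 : 0 < n := by omega
  rw [← isCovariantValuation_supportFn_iff hn0]
  constructor
  · intro h
    have hm := momentFn_id_stdSimplexBody_pos hn0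
    obtain ⟨a₁, a₃, h₃, hT1, hT2⟩ := exists_coefficients (Φ (stdSimplexBody n)) hm
    obtain ⟨a₂, a₄, h₄, hS1, hS2⟩ := exists_coefficients (Φ (stdFacetBody hn0)) hm
    refine ⟨a₁, a₂, a₃, a₄, h₃, h₄, fun K => supportFn_injective (funext fun x => ?_)⟩
    rw [supportFn_combination a₁ a₂ h₃ h₄]
    have hR := h.sub (isCovariantValuation_combination a₁ a₂ a₃ a₄)
    refine sub_eq_zero.1 (hR.eq_zero (by omega) ?_ ?_ ?_ ?_ K x)
    · refine (extend_coe (stdSimplexBody n) _).trans ?_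
      simp only [hullBody_stdSimplexBody, momentFn_abs_stdSimplexBody, hT1]
      ring
    · refine (extend_coe (stdSimplexBody n) _).trans ?_
      simp only [hullBody_stdSimplexBody, momentFn_abs_constVec_neg, momentFn_id_constVec_neg,
        momentFn_abs_stdSimplexBody, hT2]
      ring
    · refine (extend_coe (stdFacetBody hn0) _).trans ?_
      simp only [hullBody_stdFacetBody, momentFn_stdFacetBody, momentFn_abs_stdSimplexBody, hS1]
      ring
    · refine (extend_coe (stdFacetBody hn0) _).trans ?_
      simp only [hullBody_stdFacetBody, momentFn_stdFacetBody, momentFn_abs_constVec_neg,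
        momentFn_id_constVec_neg, momentFn_abs_stdSimplexBody, hS2]
      ring
  · rintro ⟨a₁, a₂, a₃, a₄, h₃, h₄, hΦ⟩
    have heq : (fun K => supportFn (Φ K)) = fun K x => a₁ * momentFn (fun t => t) K x +
        a₂ * (momentFn (fun t => t) (hullBody K) x - momentFn (fun t => t) K x) +
        a₃ * momentFn (fun t => |t|) K x +
        a₄ * (momentFn (fun t => |t|) (hullBody K) x - momentFn (fun t => |t|) K x) := by
      funext K x
      rw [hΦ K, supportFn_combination a₁ a₂ h₃ h₄]
    rw [heq]
    exact isCovariantValuation_combination a₁ a₂ a₃ a₄
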